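/- \textbf{Setting.} Write $X=(x',z)\in\mathbb R^4\times\mathbb R=\mathbb R^5$, $r=|x'|$, $d\mu_5=r^3\,dr\,dz$ on $\{r>0\}$, and let $B_\lambda(z_0)$ be the ball of $\mathbb R^5$ of radius $\lambda$ centred at the axis point $(0,z_0)$. Let $\psi$ be a real, smooth, radial function on $\mathbb R^5$ with compact support not containing $0$ and $\sum_{k\in\mathbb Z}\psi(2^{-k}\xi)=1$ for $\xi\ne0$; let $\Delta_k$ be the Littlewood--Paley block with multiplier $\psi(2^{-k}\xi)$, that is, convolution with $\Phi_k(X)=2^{5k}\Phi(2^kX)$, $\Phi=\mathcal F^{-1}\psi$. Let $S\subset\mathbb Z$ (the exponents $k$ of the scales $2^{-k}$ of the singular range), let $g=g(r,z)$ be real with $g\in L^2(d\mu_5)$, let $G(X)=g(r,z)$ be the corresponding $SO(4)$-radial field on $\mathbb R^5$, and set $$\delta:=\sup_{k\in S,\ z_0\in\mathbb R}2^{4k}\int_{B_{2^{-k}}(z_0)}|g|^2\,d\mu_5\in[0,\infty].$$ Let $k_0\le k$ be integers with $\{k_0,\dots,k\}\subset S$, and suppose that $G$ is carried by the proximal cylinder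 of scale $2^{-k_0}$: $G=0$ almost everywhere outside $\bigcup_{i\in\mathbb Z}B_{2^{-k_0}}(i2^{-k_0})$. (The case $k_0=k$ is allowed.) \textbf{Lemma (local lifted velocity block bound).} (a) Let $m=(m_1,\dots,m_5)$ be complex symbols of order $-1$, that is, each $m_i$ is smooth on $\mathbb R^5\setminus\{0\}$ with $|D^Nm_i(\xi)|\le C_N|\xi|^{-1-N}$ for every $N\ge0$, and let $U=m(D)G$, that is, $\widehat U=m\,\widehat G$. There is a constant $C$ depending only on $\psi$ and $m$ (not on $S,G,k_0,k,z_0$) such that for every $z_0\in\mathbb R$ $$\bigl\|\mathbf 1_{B_{2^{-k}}(z_0)}\,\Delta_kU\bigr\|_{L^\infty(\mathbb R^5)}\le C\sqrt{\delta}\;2^{-k/2}.$$ (b) Let $U=u_re_r+u_ze_z$ be the lift to $\mathbb R^5$ of the axisymmetric meridional velocity with $\omega_\theta/r=G$, that is, with $\varphi=(-\Delta)^{-1}G$ on $\mathbb R^5$ (multiplier $(4\pi^2|\xi|^2)^{-1}$), $u_r=-r\,\partial_z\varphi$ and $u_z=2\varphi+r\,\partial_r\varphi$. For every $J\in\mathbb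 Z$ there is a constant $C$ depending only on $\psi$ and $J$ such that the same bound holds for every $z_0\in\mathbb R$ whenever $k\ge J$. In particular the bounds hold on each lattice ball $B_j=B_{2^{-k}}(j2^{-k})$, $j\in\mathbb Z$. -/

import Mathlib

open MeasureTheory Set
open scoped FourierTransform ENNReal NNReal ContDiff

namespace LiftedFlow

noncomputable section

/-- The lifted space `ℝ⁵ = ℝ⁴ × ℝ`; a point is `X = (x', z)` with `z` the last coordinate. -/
abbrev R5 : Type := EuclideanSpace ℝ (Fin 5)

/-- The distance `r = |x'|` of `X = (x', z)` to the axis. -/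
def axisRadius (X : R5) : ℝ := √(∑ i : Fin 4, X i.castSucc ^ 2)

/-- The point `(0, z)` of the axis. -/
def axisPoint (z : ℝ) : R5 := EuclideanSpace.single (Fin.last 4) z

/-- The axis-centred ball of `ℝ⁵` with radius `lam` and centre `(0, z)`. -/
def axisBall (lam z : ℝ) : Set R5 := Metric.ball (axisPoint z) lam

/-- The same ball in the variables `(r, z)`. -/
def axisDisk (lam z : ℝ) : Set (ℝ × ℝ) := {p | p.1 ^ 2 + (p.2 - z) ^ 2 < lam ^ 2}

/-- The lifted measure `r³ dr dz` on the half-plane `r > 0`. -/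
def mu5 : Measure (ℝ × ℝ) :=
  (volume.restrict (Ioi (0 : ℝ) ×ˢ (univ : Set ℝ))).withDensity
    (fun p => ENNReal.ofReal (p.1 ^ 3))

/-- The `SO(4)`-radial field `G(X) = g(r, z)` on `ℝ⁵` with profile `g`. -/
def lift (g : ℝ × ℝ → ℝ) (X : R5) : ℂ := ((g (axisRadius X, X (Fin.last 4)) : ℝ) : ℂ)

/-- `δ = sup 2^{4k} ∫_{B_{2^{-k}}(z₀)} |g|² r³ dr dz` over all `k ∈ S` and all real `z₀`;
the set `S` consists of the exponents `k` of the scales `2^{-k}` in the singular range. -/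
def singularMass (S : Set ℤ) (g : ℝ × ℝ → ℝ) : ℝ≥0∞ :=
  ⨆ k ∈ S, ⨆ z₀ : ℝ,
    ENNReal.ofReal ((2 : ℝ) ^ (4 * k)) * ∫⁻ p in axisDisk ((2 : ℝ) ^ (-k)) z₀, ‖g p‖ₑ ^ 2 ∂mu5

/-- The profile `g` lives in the proximal cylinder of scale `2^{-k}`: it vanishes almost everywhere
outside the union of the lattice balls `B_{2^{-k}}(i 2^{-k})`, `i ∈ ℤ`. -/
def IsProximal (k : ℤ) (g : ℝ × ℝ → ℝ) : Prop :=
  ∀ᵐ p ∂mu5, p ∉ ⋃ i : ℤ, axisDisk ((2 : ℝ) ^ (-k)) (i * (2 : ℝ) ^ (-k)) → g p = 0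

/-- The bump function of a Littlewood--Paley decomposition of `ℝ⁵`: smooth, radial, supported in
an annulus, with dyadic dilates summing to one away from the origin. -/
structure IsLittlewoodPaley (ψ : R5 → ℝ) : Prop where
  contDiff : ContDiff ℝ ∞ ψ
  hasCompactSupport : HasCompactSupport ψ
  zero_notMem : (0 : R5) ∉ tsupport ψ
  radial : ∀ ξ η : R5, ‖ξ‖ = ‖η‖ → ψ ξ = ψ η
  hasSum : ∀ ξ : R5, ξ ≠ 0 → HasSum (fun k : ℤ => ψ ((2 : ℝ) ^ (-k) • ξ)) 1

/-- The kernel `Φ_k(X) = 2^{5k} Φ(2^k X)`, where `Φ` is the inverse Fourier transform of `ψ`. -/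
def lpKernel (ψ : R5 → ℝ) (k : ℤ) (X : R5) : ℂ :=
  (((2 : ℝ) ^ (5 * k) : ℝ) : ℂ) * 𝓕⁻ (fun ξ : R5 => (ψ ξ : ℂ)) ((2 : ℝ) ^ k • X)

/-- The Littlewood--Paley block `Δ_k f = Φ_k * f`, the Fourier multiplier `ψ(2^{-k} ξ)`. -/
def lpBlock {F : Type*} [NormedAddCommGroup F] [NormedSpace ℂ F]
    (ψ : R5 → ℝ) (k : ℤ) (f : R5 → F) (X : R5) : F :=
  ∫ Y, lpKernel ψ k (X - Y) • f Y

/-- A symbol of order `s` on `ℝ⁵ \ {0}`: smooth, the `N`-th derivative being `O(|ξ|^{s - N})`. -/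
structure IsSymbolOfOrder (s : ℝ) (m : R5 → ℂ) : Prop where
  contDiffOn : ContDiffOn ℝ ∞ m {0}ᶜ
  bound : ∀ N : ℕ, ∃ C : ℝ, ∀ ξ : R5, ξ ≠ 0 → ‖iteratedFDeriv ℝ N m ξ‖ ≤ C * ‖ξ‖ ^ (s - N)

open Classical in
/-- The class in `L²(ℝ⁵)` of a square-integrable function (and `0` for any other function). -/
def toL2 (f : R5 → ℂ) : Lp (α := R5) ℂ 2 volume := if h : MemLp f 2 volume then h.toLp f else 0

/-- The `L²` Fourier transform (Plancherel). -/
def fourierL2 (f : R5 → ℂ) : R5 → ℂ := (𝓕 (toL2 f) : Lp (α := R5) ℂ 2 volume)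

/-- The inverse `L²` Fourier transform (Plancherel). -/
def fourierInvL2 (f : R5 → ℂ) : R5 → ℂ := (𝓕⁻ (toL2 f) : Lp (α := R5) ℂ 2 volume)

/-- The Fourier multiplier operator `m(D)` applied to `G ∈ L²(ℝ⁵)`: the function whose Fourier
transform is `m Ĝ`. For symbols of order `-1` or `-2` the restriction of `m Ĝ` to the unit ball is
integrable and the restriction to its complement is square-integrable, so that `m(D) G` is the sum
of the inverse Fourier integral of the first and the inverse Plancherel transform of the second. -/
def multiplierOp (m : R5 → ℂ) (G : R5 → ℂ) (X : R5) : ℂ :=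
  𝓕⁻ ((Metric.closedBall (0 : R5) 1).indicator fun ξ => m ξ * fourierL2 G ξ) X
    + fourierInvL2 ((Metric.closedBall (0 : R5) 1)ᶜ.indicator fun ξ => m ξ * fourierL2 G ξ) X

/-- The vector field `m(D) G` for a vector `m = (m₁, …, m₅)` of symbols. -/
def multiplierField (m : Fin 5 → R5 → ℂ) (G : R5 → ℂ) (X : R5) : EuclideanSpace ℂ (Fin 5) :=
  WithLp.toLp 2 fun i => multiplierOp (m i) G X

/-- The symbol `1 / (4 π² |ξ|²)` of `(-Δ)⁻¹` on `ℝ⁵`. -/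
def invLaplaceSymbol (ξ : R5) : ℂ := 1 / (4 * (Real.pi : ℂ) ^ 2 * (‖ξ‖ : ℂ) ^ 2)

/-- The symbol of `∂_i (-Δ)⁻¹` on `ℝ⁵`. -/
def gradInvLaplaceSymbol (i : Fin 5) (ξ : R5) : ℂ :=
  2 * (Real.pi : ℂ) * Complex.I * (ξ i : ℂ) * invLaplaceSymbol ξ

/-- The lift to `ℝ⁵` of the meridional velocity `u_r e_r + u_z e_z` of the axisymmetric flow with
`ω_θ / r = G`. Here `φ = (-Δ)⁻¹ G` on `ℝ⁵`, the stream function is `ψ_θ = r φ`, and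
`u_r = -∂_z ψ_θ = -r ∂_z φ`, `u_z = r⁻¹ ∂_r (r ψ_θ) = 2 φ + r ∂_r φ`. -/
def meridionalVelocity (G : R5 → ℂ) (X : R5) : EuclideanSpace ℂ (Fin 5) :=
  WithLp.toLp 2 (Fin.snoc (α := fun _ => ℂ)
    (fun i : Fin 4 =>
      -((X i.castSucc : ℂ) * multiplierOp (gradInvLaplaceSymbol (Fin.last 4)) G X))
    (2 * multiplierOp invLaplaceSymbol G X
      + ∑ i : Fin 4, (X i.castSucc : ℂ) * multiplierOp (gradInvLaplaceSymbol i.castSucc) G X))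

end

end LiftedFlow

open LiftedFlow

/-! Write `a = 2^k`. After the frequency cutoff, `Δ_k m(D)` with `m` of order `s` is convolution
with a kernel of size at most `C a^(5+s) (1 + a|X|)^(-6)` (`exists_kernel_bound`). Cauchy-Schwarz
against the weight `w = (1 + a|X - Y|)^(-6)` then bounds the block at `X` by `a^(5+s) (∫
w|G|²)^(1/2) (∫ w)^(1/2)`.

Both integrals are sums over the balls of radius `2^n 2^(-k)` about the axis point. Volumes grow
like `32^n`, and so at most do the masses of `|G|²` (`axisDisk_mass_le`): up to radius `2^(-k₀)` the
definition of `δ` gives `2^(-4k) δ 16^n`, and beyond it the proximal cylinder is covered by a number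
of lattice balls linear in the radius. The weight contributes `64^(-n)`, so the series is geometric
(`lintegral_weight_le`). Power counting gives `√δ 2^((s+1/2)k)`, which is (a) for `s = -1`.

For (b), the velocity consists of an order `-2` term and of coordinates times order `-1` terms.
Write `Y_i = X_i - (X_i - Y_i)`: near the axis `|X_i| ≤ 2^(-k)`, while `X_i - Y_i` times the kernel
is `2^(-k)` times a kernel of the same type. All terms are thus `O(√δ 2^(-3k/2))`, and `k ≥ J` turns
the spare `2^(-k)` into a constant. -/

namespace LiftedFlow

/-! ### Convolution with the inverse transform of a bump, by Fourier duality. -/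

section Fourier

open Real SchwartzMap

variable {V : Type*} [NormedAddCommGroup V] [InnerProductSpace ℝ V]

/-- Modulation `ξ ↦ e^{2πi⟨ξ, X⟩} η(ξ)`. -/
noncomputable def modulate (X : V) (η : V → ℂ) (ξ : V) : ℂ := 𝐞 (inner ℝ ξ X) • η ξ

theorem contDiff_modulate (X : V) {η : V → ℂ} (hη : ContDiff ℝ ∞ η) :
    ContDiff ℝ ∞ (modulate X η) := by
  have : modulate X η = fun ξ => Complex.exp ((2 * π * inner ℝ ξ X : ℝ) * Complex.I) * η ξ := by
    ext ξ
    rw [modulate, Circle.smul_def, Real.fourierChar_apply, smul_eq_mul]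
  rw [this]
  have h : ContDiff ℝ ∞ (fun ξ : V => ((2 * π * inner ℝ ξ X : ℝ) : ℂ)) :=
    Complex.ofRealCLM.contDiff.comp (contDiff_const.mul (contDiff_id.inner ℝ contDiff_const))
  exact (h.mul contDiff_const).cexp.mul hη

theorem hasCompactSupport_modulate (X : V) {η : V → ℂ} (hc : HasCompactSupport η) :
    HasCompactSupport (modulate X η) :=
  hc.mono' fun ξ h => subset_tsupport η fun h0 => h (by simp [modulate, h0])

variable [FiniteDimensional ℝ V] [MeasurableSpace V] [BorelSpace V]

/-- Modulation in frequency is translation in space. The reflected and translated kernel is thus the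
transform of a Schwartz function and can serve as a test function. -/
theorem fourier_modulate (X : V) (η : V → ℂ) (Y : V) :
    𝓕 (modulate X η) Y = 𝓕⁻ η (X - Y) := by
  rw [fourier_eq, fourierInv_eq]
  congr 1 with ξ
  rw [modulate, smul_smul, ← AddChar.map_add_eq_mul, inner_sub_right]
  ring_nf

/-- The modulated bump as a Schwartz function. -/
noncomputable def modulateSchwartz (X : V) {η : V → ℂ} (hη : ContDiff ℝ ∞ η)
    (hc : HasCompactSupport η) : 𝓢(V, ℂ) :=
  (hasCompactSupport_modulate X hc).toSchwartzMap (contDiff_modulate X hη)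

theorem fourier_modulateSchwartz (X : V) {η : V → ℂ} (hη : ContDiff ℝ ∞ η)
    (hc : HasCompactSupport η) (Y : V) :
    𝓕 (modulateSchwartz X hη hc) Y = 𝓕⁻ η (X - Y) :=
  fourier_modulate X η Y

/-- Convolution of `𝓕⁻ η` with the inverse Fourier integral of an integrable function. -/
theorem integral_fourierInv_mul_fourierInv {η h : V → ℂ} (hη : ContDiff ℝ ∞ η)
    (hc : HasCompactSupport η) (hh : Integrable h) (X : V) :
    ∫ Y, 𝓕⁻ η (X - Y) * 𝓕⁻ h Y = ∫ ξ, modulate X η ξ * h ξ := by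
  -- The sign in `-innerₗ V` makes this the exchange formula for the inverse transform.
  have h1 := VectorFourier.integral_fourierIntegral_smul_eq_flip (μ := (volume : Measure V))
    (ν := (volume : Measure V)) (L := -innerₗ V) (f := h)
    (g := ⇑(𝓕 (modulateSchwartz X hη hc) : 𝓢(V, ℂ))) continuous_fourierChar
    (by simpa using! continuous_inner.neg) hh
    (𝓕 (modulateSchwartz X hη hc) : 𝓢(V, ℂ)).integrable
  have hflip : (-innerₗ V).flip = -innerₗ V := by
    ext x y; simp [real_inner_comm]
  rw [hflip] at h1
  have h2 : 𝓕⁻ (⇑(𝓕 (modulateSchwartz X hη hc) : 𝓢(V, ℂ))) = modulate X η := by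
    rw [← fourierInv_coe, FourierTransform.fourierInv_fourier_eq]; rfl
  change ∫ ξ, 𝓕⁻ h ξ • 𝓕 (modulateSchwartz X hη hc) ξ
    = ∫ x, h x • 𝓕⁻ (⇑(𝓕 (modulateSchwartz X hη hc) : 𝓢(V, ℂ))) x at h1
  rw [h2] at h1
  simp only [fourier_modulateSchwartz, smul_eq_mul] at h1
  simpa only [mul_comm] using h1

/-- Convolution of `𝓕⁻ η` with a square-integrable function. -/
theorem integral_fourierInv_mul_lp {η : V → ℂ} (hη : ContDiff ℝ ∞ η)
    (hc : HasCompactSupport η) (f : Lp (α := V) ℂ 2) (X : V) :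
    ∫ Y, 𝓕⁻ η (X - Y) * f Y = ∫ ξ, modulate X η ξ * (𝓕 f : Lp (α := V) ℂ 2) ξ := by
  -- The Plancherel and distributional transforms of `f` agree; both are tested on the modulated
  -- bump.
  have h := congrArg (fun T => T (modulateSchwartz X hη hc))
    (Lp.fourier_toTemperedDistribution_eq f)
  simp only [TemperedDistribution.fourier_apply, Lp.toTemperedDistribution_apply, smul_eq_mul,
    fourier_modulateSchwartz] at h
  exact h

theorem integrable_fourierInv_sub_mul_lp {η : V → ℂ} (hη : ContDiff ℝ ∞ η)
    (hc : HasCompactSupport η) {f : V → ℂ} (hf : MemLp f 2) (X : V) :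
    Integrable fun Y => 𝓕⁻ η (X - Y) * f Y := by
  have := ((𝓕 (modulateSchwartz X hη hc)).memLp 2).integrable_mul hf
  refine this.congr (.of_forall fun Y => ?_)
  simp [fourier_modulateSchwartz]

theorem integrable_fourierInv_sub_mul_fourierInv {η : V → ℂ} (hη : ContDiff ℝ ∞ η)
    (hc : HasCompactSupport η) {h : V → ℂ} (hh : Integrable h) (X : V) :
    Integrable fun Y => 𝓕⁻ η (X - Y) * 𝓕⁻ h Y := by
  have hcont : Continuous (𝓕⁻ h) :=
    VectorFourier.fourierIntegral_continuous continuous_fourierChar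
      (by simpa using! continuous_inner.neg) hh
  have := (𝓕 (modulateSchwartz X hη hc)).integrable (μ := volume).mul_bdd (c := ∫ v, ‖h v‖)
    hcont.aestronglyMeasurable (.of_forall fun Y =>
      VectorFourier.norm_fourierIntegral_le_integral_norm 𝐞 volume (-innerₗ V) h Y)
  refine this.congr (.of_forall fun Y => ?_)
  simp [fourier_modulateSchwartz]

theorem integrable_modulate_mul {η h : V → ℂ} (hη : ContDiff ℝ ∞ η)
    (hc : HasCompactSupport η) (hh : Integrable h) (X : V) :
    Integrable fun ξ => modulate X η ξ * h ξ := by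
  have hm := contDiff_modulate X hη
  obtain ⟨C, hC⟩ := hm.continuous.bounded_above_of_compact_support (hasCompactSupport_modulate X hc)
  exact hh.bdd_mul hm.continuous.aestronglyMeasurable (.of_forall hC)

theorem integrable_modulate_mul_lp {η h : V → ℂ} (hη : ContDiff ℝ ∞ η)
    (hc : HasCompactSupport η) (hh : MemLp h 2) (X : V) :
    Integrable fun ξ => modulate X η ξ * h ξ :=
  ((modulateSchwartz X hη hc).memLp 2).integrable_mul hh

/-- Scaling of the inverse Fourier transform. -/
theorem fourierInv_comp_inv_smul (f : V → ℂ) {a : ℝ} (ha : 0 < a) (X : V) :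
    𝓕⁻ (fun ξ => f (a⁻¹ • ξ)) X = ((a ^ Module.finrank ℝ V : ℝ) : ℂ) * 𝓕⁻ f (a • X) := by
  rw [fourierInv_eq, fourierInv_eq]
  have := Measure.integral_comp_inv_smul_of_nonneg (volume : Measure V)
    (fun v => 𝐞 (inner ℝ v (a • X)) • f v) ha.le
  rw [Complex.real_smul] at this
  rw [← this]
  congr 1 with v
  rw [real_inner_smul_left, real_inner_smul_right, inv_mul_cancel_left₀ ha.ne']

end Fourier

/-! ### Frequency-localised multiplier operators as convolutions. -/

section Multiplier

theorem toL2_of_memLp {f : R5 → ℂ} (h : MemLp f 2) : toL2 f = h.toLp f := by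
  rw [toL2, dif_pos h]

/-- The two parts of `m Ĝ` for which `multiplierOp` makes sense. -/
structure IsAdmissible (m : R5 → ℂ) (G : R5 → ℂ) : Prop where
  low : Integrable ((Metric.closedBall (0 : R5) 1).indicator fun ξ => m ξ * fourierL2 G ξ)
  high : MemLp ((Metric.closedBall (0 : R5) 1)ᶜ.indicator fun ξ => m ξ * fourierL2 G ξ) 2

theorem fourierInvL2_memLp (h : R5 → ℂ) : MemLp (fourierInvL2 h) 2 := Lp.memLp _

theorem integrable_fourierInv_sub_mul_multiplierOp {η m G : R5 → ℂ} (hη : ContDiff ℝ ∞ η)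
    (hc : HasCompactSupport η) (hm : IsAdmissible m G) (X : R5) :
    Integrable fun Y => 𝓕⁻ η (X - Y) * multiplierOp m G Y := by
  simp only [multiplierOp, mul_add]
  exact (integrable_fourierInv_sub_mul_fourierInv hη hc hm.low X).add
    (integrable_fourierInv_sub_mul_lp hη hc (fourierInvL2_memLp _) X)

/-- A smooth frequency cutoff turns the multiplier operator into a convolution operator. -/
theorem integral_fourierInv_mul_multiplierOp {η m G : R5 → ℂ} (hη : ContDiff ℝ ∞ η)
    (hc : HasCompactSupport η) (hηm : ContDiff ℝ ∞ fun ξ => η ξ * m ξ)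
    (hm : IsAdmissible m G) (hG : MemLp G 2) (X : R5) :
    ∫ Y, 𝓕⁻ η (X - Y) * multiplierOp m G Y
      = ∫ Y, 𝓕⁻ (fun ξ => η ξ * m ξ) (X - Y) * G Y := by
  have hcm : HasCompactSupport fun ξ => η ξ * m ξ := hc.mul_right
  have e1 : ∫ Y, 𝓕⁻ (fun ξ => η ξ * m ξ) (X - Y) * G Y
      = ∫ ξ, modulate X (fun ξ => η ξ * m ξ) ξ * fourierL2 G ξ := by
    rw [fourierL2, ← integral_fourierInv_mul_lp hηm hcm, toL2_of_memLp hG]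
    refine integral_congr_ae ?_
    filter_upwards [hG.coeFn_toLp] with Y hY
    rw [hY]
  set l := (Metric.closedBall (0 : R5) 1).indicator fun ξ => m ξ * fourierL2 G ξ
  set h := (Metric.closedBall (0 : R5) 1)ᶜ.indicator fun ξ => m ξ * fourierL2 G ξ with hh
  have e2 : ∫ Y, 𝓕⁻ η (X - Y) * fourierInvL2 h Y = ∫ ξ, modulate X η ξ * h ξ := by
    rw [fourierInvL2, integral_fourierInv_mul_lp hη hc, FourierTransform.fourier_fourierInv_eq,
      toL2_of_memLp hm.high]
    refine integral_congr_ae ?_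
    filter_upwards [hm.high.coeFn_toLp] with ξ hξ
    rw [hξ]
  simp only [multiplierOp, mul_add]
  rw [integral_add (integrable_fourierInv_sub_mul_fourierInv hη hc hm.low X)
    (integrable_fourierInv_sub_mul_lp hη hc (fourierInvL2_memLp _) X),
    integral_fourierInv_mul_fourierInv hη hc hm.low, e2, e1, ← integral_add
    (integrable_modulate_mul hη hc hm.low X) (integrable_modulate_mul_lp hη hc hm.high X)]
  -- The low and high frequency parts recombine into `m Ĝ`.
  congr 1 with ξ
  rw [← mul_add, Set.indicator_self_add_compl_apply]
  simp [modulate, Circle.smul_def, mul_assoc]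

end Multiplier

/-! ### Kernel bounds for localised symbols. -/

section Symbols

open Real

theorem norm_iteratedFDeriv_comp_smul_le {E F : Type*} [NormedAddCommGroup E] [NormedSpace ℝ E]
    [NormedAddCommGroup F] [NormedSpace ℝ F] (f : E → F) {a : ℝ} (ha : 0 < a) (N : ℕ) (x : E) :
    ‖iteratedFDeriv ℝ N (fun y => f (a • y)) x‖ ≤ a ^ N * ‖iteratedFDeriv ℝ N f (a • x)‖ := by
  let g : E ≃L[ℝ] E := ContinuousLinearEquiv.smulLeft (Units.mk0 a ha.ne')
  have hg : ∀ y, g y = a • y := fun y => rfl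
  have h := g.iteratedFDerivWithin_comp_right f uniqueDiffOn_univ (mem_univ (g x)) N
  rw [preimage_univ, iteratedFDerivWithin_univ, iteratedFDerivWithin_univ] at h
  change ‖iteratedFDeriv ℝ N (f ∘ g) x‖ ≤ _
  rw [h, hg]
  refine (ContinuousMultilinearMap.norm_compContinuousLinearMap_le _ _).trans ?_
  rw [Finset.prod_const, Finset.card_univ, Fintype.card_fin, mul_comm]
  gcongr
  refine ContinuousLinearMap.opNorm_le_bound _ ha.le fun y => ?_
  change ‖a • y‖ ≤ _
  rw [norm_smul, Real.norm_of_nonneg ha.le]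

variable {s : ℝ} {m η : R5 → ℂ}

theorem IsSymbolOfOrder.contDiffAt (hm : IsSymbolOfOrder s m) {ξ : R5} (hξ : ξ ≠ 0) :
    ContDiffAt ℝ ∞ m ξ :=
  hm.contDiffOn.contDiffAt (isOpen_compl_singleton.mem_nhds hξ)

/-- The chain rule factor `a^N` cancels the `a^(-N)` of the symbol bound, so every derivative
carries the same power `a^s`. -/
theorem IsSymbolOfOrder.norm_iteratedFDeriv_dilate_le (hm : IsSymbolOfOrder s m) (N : ℕ) :
    ∃ C : ℝ, 0 ≤ C ∧ ∀ a : ℝ, 0 < a → ∀ ξ : R5, ξ ≠ 0 →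
      ‖iteratedFDeriv ℝ N (fun y => m (a • y)) ξ‖ ≤ a ^ s * (C * ‖ξ‖ ^ (s - N)) := by
  obtain ⟨C, hC⟩ := hm.bound N
  refine ⟨max C 0, le_max_right _ _, fun a ha ξ hξ => ?_⟩
  calc _ ≤ a ^ N * ‖iteratedFDeriv ℝ N m (a • ξ)‖ := norm_iteratedFDeriv_comp_smul_le m ha N ξ
    _ ≤ a ^ N * (max C 0 * ‖a • ξ‖ ^ (s - N)) := by
      gcongr
      refine (hC _ (smul_ne_zero ha.ne' hξ)).trans ?_
      gcongr
      exact le_max_left _ _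
    _ = a ^ s * (max C 0 * ‖ξ‖ ^ (s - N)) := by
      rw [norm_smul, Real.norm_of_nonneg ha.le, Real.mul_rpow ha.le (norm_nonneg _),
        Real.rpow_sub ha, Real.rpow_natCast]
      field_simp

theorem IsSymbolOfOrder.contDiff_mul_dilate (hm : IsSymbolOfOrder s m) (hη : ContDiff ℝ ∞ η)
    (h0 : (0 : R5) ∉ tsupport η) {a : ℝ} (ha : 0 < a) :
    ContDiff ℝ ∞ fun ξ => η ξ * m (a • ξ) := by
  rw [contDiff_iff_contDiffAt]
  intro ξ
  by_cases hξ : ξ = 0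
  · subst hξ
    have : (fun ξ => η ξ * m (a • ξ)) =ᶠ[nhds 0] fun _ => 0 := by
      filter_upwards [notMem_tsupport_iff_eventuallyEq.1 h0] with y hy
      simp [hy]
    exact contDiffAt_const.congr_of_eventuallyEq this
  · refine hη.contDiffAt.mul ?_
    exact (hm.contDiffAt (smul_ne_zero ha.ne' hξ)).comp ξ (contDiff_const_smul a).contDiffAt

/-- Leibniz' rule on the support of `η`, a compact set away from `0` on which every power of `‖ξ‖`
is bounded; this makes the bound uniform in `a`. -/
theorem IsSymbolOfOrder.norm_iteratedFDeriv_mul_dilate_le (hm : IsSymbolOfOrder s m)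
    (hη : ContDiff ℝ ∞ η) (hc : HasCompactSupport η) (h0 : (0 : R5) ∉ tsupport η) (N : ℕ) :
    ∃ B : ℝ, 0 ≤ B ∧ ∀ a : ℝ, 0 < a → ∀ ξ : R5,
      ‖iteratedFDeriv ℝ N (fun y => η y * m (a • y)) ξ‖ ≤ a ^ s * B := by
  choose C hC0 hC using hm.norm_iteratedFDeriv_dilate_le
  have hE : ∀ i : ℕ, ∃ E : ℝ, ∀ ξ, ‖iteratedFDeriv ℝ i η ξ‖ ≤ E := fun i =>
    (hη.continuous_iteratedFDeriv (mod_cast le_top)).bounded_above_of_compact_support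
      (hc.iteratedFDeriv i)
  choose E hE using hE
  have hM : ∀ j : ℕ, ∃ M : ℝ, ∀ ξ ∈ tsupport η, ‖‖ξ‖ ^ (s - j)‖ ≤ M := fun j =>
    IsCompact.exists_bound_of_continuousOn (f := fun ξ : R5 => ‖ξ‖ ^ (s - j)) hc fun ξ hξ =>
      (continuous_norm.continuousAt.rpow_const (Or.inl (norm_ne_zero_iff.2 fun h =>
        h0 (h ▸ hξ)))).continuousWithinAt
  choose M hM using hM
  set B := ∑ i ∈ Finset.range (N + 1), (N.choose i : ℝ) * E i * (C (N - i) * M (N - i))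
  -- The chosen bounds `M` may be negative when the support is empty.
  refine ⟨max B 0, le_max_right _ _, fun a ha ξ => ?_⟩
  by_cases hξ : ξ ∈ tsupport η
  · have hξ0 : ξ ≠ 0 := fun h => h0 (h ▸ hξ)
    have hma : ContDiffOn ℝ ∞ (fun y => m (a • y)) {0}ᶜ := fun y hy =>
      ((hm.contDiffAt (smul_ne_zero ha.ne' hy)).comp y
        (contDiff_const_smul a).contDiffAt).contDiffWithinAt
    have hL := norm_iteratedFDerivWithin_mul_le (n := N) hη.contDiffOn hma
      (isOpen_compl_singleton (x := (0 : R5))).uniqueDiffOn hξ0 (mod_cast le_top)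
    simp only [iteratedFDerivWithin_of_isOpen _ (isOpen_compl_singleton (x := (0 : R5)))
      (show ξ ∈ ({0}ᶜ : Set R5) from hξ0)] at hL
    refine hL.trans ?_
    calc _ ≤ ∑ i ∈ Finset.range (N + 1),
          (N.choose i : ℝ) * E i * (a ^ s * (C (N - i) * M (N - i))) := by
          refine Finset.sum_le_sum fun i _ => ?_
          have hE0 : 0 ≤ E i := (norm_nonneg _).trans (hE i ξ)
          gcongr
          · exact hE i ξ
          · refine (hC _ a ha ξ hξ0).trans ?_
            have := hC0 (N - i)
            gcongr
            exact (le_abs_self _).trans (hM (N - i) ξ hξ)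
      _ = a ^ s * B := by
          rw [Finset.mul_sum]
          exact Finset.sum_congr rfl fun i _ => by ring
      _ ≤ a ^ s * max B 0 := by gcongr; exact le_max_left _ _
  · have : iteratedFDeriv ℝ N (fun y => η y * m (a • y)) ξ = 0 := by
      by_contra h
      exact hξ (tsupport_mul_subset_left (support_iteratedFDeriv_subset N h))
    rw [this, norm_zero]
    positivity

/-- Decay of order `n` costs `n` derivatives, integrated over `tsupport η`, whose volume does not
depend on `a`. -/
theorem IsSymbolOfOrder.norm_fourier_mul_dilate_le (hm : IsSymbolOfOrder s m)
    (hη : ContDiff ℝ ∞ η) (hc : HasCompactSupport η) (h0 : (0 : R5) ∉ tsupport η) (n : ℕ) :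
    ∃ C : ℝ, 0 ≤ C ∧ ∀ a : ℝ, 0 < a → ∀ X : R5,
      ‖X‖ ^ n * ‖𝓕 (fun ξ => η ξ * m (a • ξ)) X‖ ≤ a ^ s * C := by
  choose B hB0 hB using hm.norm_iteratedFDeriv_mul_dilate_le hη hc h0
  refine ⟨2 ^ n * ∑ p ∈ Finset.range (n + 1), B p * volume.real (tsupport η), ?_,
    fun a ha X => ?_⟩
  · have := fun p => mul_nonneg (hB0 p) (measureReal_nonneg (μ := volume) (s := tsupport η))
    exact mul_nonneg (by positivity) (Finset.sum_nonneg fun p _ => this p)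
  have hf := hm.contDiff_mul_dilate hη h0 ha
  have hcf : HasCompactSupport fun ξ => η ξ * m (a • ξ) := hc.mul_right
  have h := Real.pow_mul_norm_iteratedFDeriv_fourier_le (K := ⊤) (N := ⊤) hf
    (fun k n _ _ => (hcf.toSchwartzMap hf).integrable_pow_mul_iteratedFDeriv volume k n)
    (k := 0) (n := n) le_top le_top X
  have hint : ∀ p : ℕ, ∫ v, ‖iteratedFDeriv ℝ p (fun ξ => η ξ * m (a • ξ)) v‖
      ≤ a ^ s * (B p * volume.real (tsupport η)) := by
    intro p
    rw [← setIntegral_eq_integral_of_forall_compl_eq_zero (s := tsupport η), ← mul_assoc]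
    · refine (Real.le_norm_self _).trans
        (norm_setIntegral_le_of_norm_le_const (IsCompact.measure_lt_top hc) fun v _ => ?_)
      rw [norm_norm]
      exact hB p a ha v
    · intro v hv
      rw [norm_eq_zero]
      by_contra h
      exact hv (tsupport_mul_subset_left (support_iteratedFDeriv_subset p h))
  simp only [norm_iteratedFDeriv_zero, pow_zero, one_mul, CharP.cast_eq_zero, mul_zero, zero_add,
    Finset.range_one, Finset.singleton_product, Finset.sum_map, Function.Embedding.coeFn_mk] at h
  refine h.trans ?_
  refine (mul_le_mul_of_nonneg_left (Finset.sum_le_sum fun p _ => hint p)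
    (by positivity)).trans_eq ?_
  rw [← Finset.mul_sum]
  ring

/-- The kernel of a localised symbol of order `s` at frequency `a`. -/
theorem IsSymbolOfOrder.exists_kernel_bound (hm : IsSymbolOfOrder s m)
    (hη : ContDiff ℝ ∞ η) (hc : HasCompactSupport η) (h0 : (0 : R5) ∉ tsupport η) :
    ∃ C : ℝ, 0 ≤ C ∧ ∀ a : ℝ, 0 < a → ∀ X : R5,
      ‖𝓕⁻ (fun ξ => η (a⁻¹ • ξ) * m ξ) X‖ ≤ C * (a ^ 5 * a ^ s) * ((1 + a * ‖X‖) ^ 6)⁻¹ := by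
  -- Orders `0` and `6` combine through `(1 + t)^6 ≤ 2^5 (1 + t^6)`. Any decay exponent above the
  -- dimension `5` would serve.
  obtain ⟨C0, hC0, h0'⟩ := hm.norm_fourier_mul_dilate_le hη hc h0 0
  obtain ⟨C6, hC6, h6⟩ := hm.norm_fourier_mul_dilate_le hη hc h0 6
  refine ⟨2 ^ 5 * (C0 + C6), by positivity, fun a ha X => ?_⟩
  have e : (fun ξ => η (a⁻¹ • ξ) * m ξ)
      = fun ξ => (fun y => η y * m (a • y)) (a⁻¹ • ξ) := by
    ext ξ
    simp only [smul_inv_smul₀ ha.ne']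
  rw [e, fourierInv_comp_inv_smul (fun y => η y * m (a • y)) ha, Real.fourierInv_eq_fourier_neg, norm_mul,
    Complex.norm_of_nonneg (by positivity), finrank_euclideanSpace_fin]
  have a0 := h0' a ha (-(a • X))
  have a6 := h6 a ha (-(a • X))
  set F := ‖𝓕 (fun y => η y * m (a • y)) (-(a • X))‖
  rw [norm_neg, norm_smul, Real.norm_of_nonneg ha.le] at a0 a6
  have hp := add_pow_le zero_le_one (mul_nonneg ha.le (norm_nonneg X)) 6
  have hF : 0 ≤ F := norm_nonneg _
  rw [← div_eq_mul_inv, le_div_iff₀ (by positivity)]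
  calc a ^ 5 * F * (1 + a * ‖X‖) ^ 6 ≤ a ^ 5 * F * (2 ^ 5 * (1 ^ 6 + (a * ‖X‖) ^ 6)) := by
        gcongr
    _ = a ^ 5 * 2 ^ 5 * ((a * ‖X‖) ^ 0 * F + (a * ‖X‖) ^ 6 * F) := by ring
    _ ≤ a ^ 5 * 2 ^ 5 * (a ^ s * C0 + a ^ s * C6) := by gcongr
    _ = _ := by ring

end Symbols

/-! ### Integrability of the two frequency parts. -/

section Admissible

variable {s : ℝ} {m : R5 → ℂ}

theorem IsSymbolOfOrder.aestronglyMeasurable (hm : IsSymbolOfOrder s m) :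
    AEStronglyMeasurable m (volume : Measure R5) := by
  rw [← restrict_compl_singleton (μ := (volume : Measure R5)) 0]
  exact hm.contDiffOn.continuousOn.aestronglyMeasurable (measurableSet_singleton _).compl

theorem IsSymbolOfOrder.exists_norm_le (hm : IsSymbolOfOrder s m) :
    ∃ C : ℝ, 0 ≤ C ∧ ∀ ξ : R5, ξ ≠ 0 → ‖m ξ‖ ≤ C * ‖ξ‖ ^ s := by
  obtain ⟨C, hC⟩ := hm.bound 0
  refine ⟨max C 0, le_max_right _ _, fun ξ hξ => ?_⟩
  have := hC ξ hξ
  rw [norm_iteratedFDeriv_zero, Nat.cast_zero, sub_zero] at this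
  refine this.trans ?_
  gcongr
  exact le_max_left _ _

theorem fourierL2_memLp (G : R5 → ℂ) : MemLp (fourierL2 G) 2 := Lp.memLp _

/-- In dimension five `‖ξ‖^(2s)` is integrable at the origin exactly when `s > -5/2`, so
Cauchy-Schwarz handles the low part; `s ≤ 0` keeps `m` bounded on the high part. -/
theorem IsSymbolOfOrder.isAdmissible (hm : IsSymbolOfOrder s m) (hs : -(5 / 2) < s) (hs0 : s ≤ 0)
    (G : R5 → ℂ) : IsAdmissible m G := by
  obtain ⟨C, hC0, hC⟩ := hm.exists_norm_le
  have hmm := hm.aestronglyMeasurable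
  have hne : ∀ᵐ ξ : R5, ξ ≠ 0 := by simp [ae_iff]
  constructor
  · have h1 : IntegrableOn (fun ξ => ‖m ξ‖ ^ 2) (Metric.ball (0 : R5) 2) := by
      refine integrableOn_ball_of_norm_le_rpow (C := C ^ 2) (α := -(2 * s)) (by simp) ?_
        (ae_restrict_of_ae ?_) (hmm.norm.pow 2)
      · rw [finrank_euclideanSpace_fin]; push_cast; linarith
      · filter_upwards [hne] with ξ hξ
        rw [neg_neg, mul_comm 2 s, Real.rpow_mul (norm_nonneg _), Real.rpow_ofNat, ← mul_pow,
          Real.norm_of_nonneg (by positivity)]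
        gcongr
        exact hC ξ hξ
    have h2 : MemLp m 2 (volume.restrict (Metric.closedBall (0 : R5) 1)) :=
      (memLp_two_iff_integrable_sq_norm hmm.restrict).2
        (h1.mono_set (Metric.closedBall_subset_ball (by norm_num)))
    have h3 : IntegrableOn (fun ξ => m ξ * fourierL2 G ξ) (Metric.closedBall (0 : R5) 1) :=
      h2.integrable_mul ((fourierL2_memLp G).restrict _)
    exact h3.integrable_indicator measurableSet_closedBall
  · refine (fourierL2_memLp G).of_le_mul (c := C)
      ((hmm.mul (fourierL2_memLp G).1).indicator measurableSet_closedBall.compl)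
      (.of_forall fun ξ => ?_)
    by_cases hξ : ξ ∈ (Metric.closedBall (0 : R5) 1)ᶜ
    · have h1 : 1 < ‖ξ‖ := by simpa using hξ
      rw [indicator_of_mem hξ, norm_mul]
      gcongr
      refine (hC ξ (norm_pos_iff.1 (by linarith))).trans ?_
      exact mul_le_of_le_one_right hC0 (Real.rpow_le_one_of_one_le_of_nonpos h1.le hs0)
    · rw [indicator_of_notMem hξ, norm_zero]
      positivity

end Admissible

/-! ### The symbols of the inverse Laplacian and its gradient. -/

section Homogeneous

/-- Homogeneity reduces each derivative bound to the unit sphere, where compactness gives the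
constant. -/
theorem isSymbolOfOrder_of_homogeneous {s : ℝ} {m : R5 → ℂ} (hm : ContDiffOn ℝ ∞ m {0}ᶜ)
    (hh : ∀ a : ℝ, 0 < a → ∀ ξ : R5, m (a • ξ) = (a ^ s : ℝ) • m ξ) : IsSymbolOfOrder s m := by
  refine ⟨hm, fun N => ?_⟩
  have hcont : ContinuousOn (iteratedFDeriv ℝ N m) (Metric.sphere (0 : R5) 1) := by
    have h1 := hm.continuousOn_iteratedFDerivWithin (m := N) (mod_cast le_top)
      (isOpen_compl_singleton (x := (0 : R5))).uniqueDiffOn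
    refine (h1.congr fun ξ hξ =>
      (iteratedFDerivWithin_of_isOpen N isOpen_compl_singleton hξ).symm).mono fun ξ hξ => ?_
    simp only [mem_compl_iff, mem_singleton_iff]
    rintro rfl
    simp at hξ
  obtain ⟨C, hC⟩ := (isCompact_sphere (0 : R5) 1).exists_bound_of_continuousOn hcont
  refine ⟨C, fun ξ hξ => ?_⟩
  have hn : 0 < ‖ξ‖ := norm_pos_iff.2 hξ
  set a := ‖ξ‖⁻¹
  have ha : 0 < a := inv_pos.2 hn
  have e : m = fun y => (a ^ (-s) : ℝ) • m (a • y) := by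
    ext y
    rw [hh a ha, smul_smul, ← Real.rpow_add ha]
    simp
  have hsm : ContDiffAt ℝ N (fun y => m (a • y)) ξ :=
    ((hm.contDiffAt (isOpen_compl_singleton.mem_nhds (smul_ne_zero ha.ne' hξ))).comp ξ
      (contDiff_const_smul a).contDiffAt).of_le (mod_cast le_top)
  have hsph : a • ξ ∈ Metric.sphere (0 : R5) 1 := by
    rw [mem_sphere_zero_iff_norm, norm_smul, Real.norm_of_nonneg ha.le]
    exact inv_mul_cancel₀ hn.ne'
  rw [e, iteratedFDeriv_const_smul_apply' hsm, norm_smul, Real.norm_of_nonneg (by positivity)]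
  calc _ ≤ a ^ (-s) * (a ^ N * ‖iteratedFDeriv ℝ N m (a • ξ)‖) := by
        gcongr
        exact norm_iteratedFDeriv_comp_smul_le m ha N ξ
    _ ≤ a ^ (-s) * (a ^ N * C) := by
        gcongr
        exact hC _ hsph
    _ = C * ‖ξ‖ ^ (s - N) := by
        simp only [a]
        rw [Real.inv_rpow hn.le, Real.rpow_neg hn.le, inv_inv, Real.rpow_sub hn, Real.rpow_natCast,
          inv_pow]
        ring

theorem contDiffOn_invLaplaceSymbol : ContDiffOn ℝ ∞ invLaplaceSymbol {0}ᶜ := by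
  have e : invLaplaceSymbol = fun ξ => 1 / (4 * (Real.pi : ℂ) ^ 2 * ((‖ξ‖ ^ 2 : ℝ) : ℂ)) := by
    ext ξ; simp [invLaplaceSymbol]
  rw [e]
  have h : ContDiff ℝ ∞ fun ξ : R5 => ((‖ξ‖ ^ 2 : ℝ) : ℂ) :=
    Complex.ofRealCLM.contDiff.comp (contDiff_norm_sq ℝ)
  have h' : ContDiff ℝ ∞ fun ξ : R5 => 4 * (Real.pi : ℂ) ^ 2 * ((‖ξ‖ ^ 2 : ℝ) : ℂ) :=
    contDiff_const.mul h
  refine ContDiffOn.congr (h'.contDiffOn.inv fun ξ hξ => ?_) fun ξ _ => one_div _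
  have : ξ ≠ 0 := hξ
  simp [Real.pi_ne_zero, this]

theorem invLaplaceSymbol_smul {a : ℝ} (ha : 0 < a) (ξ : R5) :
    invLaplaceSymbol (a • ξ) = (a ^ (-2 : ℝ) : ℝ) • invLaplaceSymbol ξ := by
  rw [Real.rpow_neg ha.le, Real.rpow_ofNat]
  simp only [invLaplaceSymbol, norm_smul, Real.norm_of_nonneg ha.le, Complex.real_smul]
  push_cast
  rw [mul_pow, one_div, one_div, ← mul_inv]
  ring_nf

theorem isSymbolOfOrder_invLaplaceSymbol : IsSymbolOfOrder (-2) invLaplaceSymbol :=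
  isSymbolOfOrder_of_homogeneous contDiffOn_invLaplaceSymbol fun _ ha => invLaplaceSymbol_smul ha

theorem isSymbolOfOrder_gradInvLaplaceSymbol (i : Fin 5) :
    IsSymbolOfOrder (-1) (gradInvLaplaceSymbol i) := by
  refine isSymbolOfOrder_of_homogeneous ?_ fun a ha ξ => ?_
  · have h : ContDiff ℝ ∞ fun ξ : R5 => ((ξ i : ℝ) : ℂ) :=
      Complex.ofRealCLM.contDiff.comp (EuclideanSpace.proj (𝕜 := ℝ) i).contDiff
    exact (contDiff_const.mul h).contDiffOn.mul contDiffOn_invLaplaceSymbol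
  · simp only [gradInvLaplaceSymbol]
    rw [invLaplaceSymbol_smul ha, show (-1 : ℝ) = -2 + 1 by norm_num, Real.rpow_add ha,
      Real.rpow_one]
    simp only [Complex.real_smul, PiLp.smul_apply, smul_eq_mul]
    push_cast
    ring

end Homogeneous

/-! ### Cylindrical coordinates and the lifted measure. -/

section Meridian

theorem lintegral_fun_norm_addHaar {E : Type*} [NormedAddCommGroup E] [NormedSpace ℝ E]
    [Nontrivial E] [MeasurableSpace E] [BorelSpace E] [FiniteDimensional ℝ E] (μ : Measure E)
    [μ.IsAddHaarMeasure] {f : ℝ → ℝ≥0∞} (hf : Measurable f) :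
    ∫⁻ x, f ‖x‖ ∂μ = μ.toSphere univ *
      ∫⁻ r in Ioi (0 : ℝ), ENNReal.ofReal (r ^ (Module.finrank ℝ E - 1)) * f r :=
  calc
    ∫⁻ x, f ‖x‖ ∂μ = ∫⁻ x : ({0}ᶜ : Set E), f ‖x.1‖ ∂(μ.comap (↑)) := by
      rw [lintegral_subtype_comap (measurableSet_singleton _).compl fun x => f ‖x‖,
        restrict_compl_singleton]
    _ = ∫⁻ x, f x.2 ∂μ.toSphere.prod (.volumeIoiPow (Module.finrank ℝ E - 1)) := by
      rw [← μ.measurePreserving_homeomorphUnitSphereProd.lintegral_comp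
        (f := fun x => f x.2) (by fun_prop)]
      simp
    _ = μ.toSphere univ * ∫⁻ x : Ioi (0 : ℝ), f x ∂.volumeIoiPow (Module.finrank ℝ E - 1) := by
      rw [lintegral_prod _ (by fun_prop)]
      simp only [lintegral_const]
      rw [mul_comm]
    _ = _ := by
      rw [Measure.volumeIoiPow, lintegral_withDensity_eq_lintegral_mul _ (by fun_prop)
        (by fun_prop)]
      congr 1
      exact lintegral_subtype_comap measurableSet_Ioi
        fun r => ENNReal.ofReal (r ^ (Module.finrank ℝ E - 1)) * f r

/-- The area of the unit sphere of `ℝ⁴`. -/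
noncomputable def sphereArea : ℝ≥0∞ :=
  (volume : Measure (EuclideanSpace ℝ (Fin 4))).toSphere univ

theorem sphereArea_ne_top : sphereArea ≠ ⊤ := measure_ne_top _ _

theorem map_norm_volume :
    (volume : Measure (EuclideanSpace ℝ (Fin 4))).map (fun x => ‖x‖)
      = sphereArea • (volume.restrict (Ioi (0 : ℝ))).withDensity
          fun r => ENNReal.ofReal (r ^ 3) := by
  ext A hA
  have h := lintegral_fun_norm_addHaar (volume : Measure (EuclideanSpace ℝ (Fin 4)))
    (f := A.indicator 1) (measurable_one.indicator hA)
  rw [Measure.map_apply measurable_norm hA, Measure.smul_apply, withDensity_apply _ hA,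
    ← lintegral_indicator_one (measurable_norm hA), ← lintegral_indicator hA]
  refine h.trans ?_
  rw [finrank_euclideanSpace_fin, smul_eq_mul, sphereArea]
  congr 2 with r
  by_cases hr : r ∈ A <;> simp [hr]

/-- The cylindrical coordinates `(r, z)` of a point of `ℝ⁵`. -/
noncomputable def meridian (X : R5) : ℝ × ℝ := (axisRadius X, X (Fin.last 4))

/-- Split off the axial coordinate and use polar coordinates in the remaining `ℝ⁴`. This transfers
masses between the half-plane and `ℝ⁵` up to the factor `sphereArea`. -/
theorem measurePreserving_meridian :
    MeasurePreserving meridian volume (sphereArea • mu5) := by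
  have h1 := (volume_preserving_piFinSuccAbove (fun _ : Fin 5 => ℝ) (Fin.last 4)).comp
    (PiLp.volume_preserving_ofLp (Fin 5))
  have h2 := Measure.measurePreserving_swap (μ := (volume : Measure ℝ))
    (ν := (volume : Measure (Fin 4 → ℝ)))
  have h3 : MeasurePreserving (fun x : Fin 4 → ℝ => ‖WithLp.toLp 2 x‖) volume
      (sphereArea • (volume.restrict (Ioi (0 : ℝ))).withDensity
          fun r => ENNReal.ofReal (r ^ 3)) :=
    (⟨measurable_norm, map_norm_volume⟩ : MeasurePreserving _ _ _).comp
      (PiLp.volume_preserving_toLp (Fin 4))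
  have h4 := (h3.prod (MeasurePreserving.id (volume : Measure ℝ))).comp (h2.comp h1)
  have e : sphereArea • mu5 = (sphereArea • (volume.restrict (Ioi (0 : ℝ))).withDensity
          fun r => ENNReal.ofReal (r ^ 3)).prod (volume : Measure ℝ) := by
    rw [Measure.prod_smul_left, prod_withDensity_left (by fun_prop), mu5,
      ← Measure.restrict_univ (μ := (volume : Measure ℝ)), Measure.prod_restrict,
      Measure.restrict_univ]
    rfl
  rw [e]
  have hfun : meridian = Prod.map (fun x : Fin 4 → ℝ => ‖WithLp.toLp 2 x‖) id ∘ Prod.swap ∘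
      MeasurableEquiv.piFinSuccAbove (fun _ : Fin 5 => ℝ) (Fin.last 4) ∘ WithLp.ofLp := by
    funext X
    refine Prod.ext ?_ rfl
    change axisRadius X = ‖WithLp.toLp 2 fun j : Fin 4 => X ((Fin.last 4).succAbove j)‖
    simp only [axisRadius, EuclideanSpace.norm_eq, Fin.succAbove_last, Real.norm_eq_abs, sq_abs]
  rw [hfun]
  exact h4

theorem norm_sub_axisPoint_sq (X : R5) (z : ℝ) :
    ‖X - axisPoint z‖ ^ 2 = (meridian X).1 ^ 2 + ((meridian X).2 - z) ^ 2 := by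
  rw [EuclideanSpace.norm_sq_eq, Fin.sum_univ_castSucc, meridian, axisRadius,
    Real.sq_sqrt (Finset.sum_nonneg fun i _ => sq_nonneg _)]
  have h : ∀ x : Fin 4, x.castSucc ≠ (4 : Fin 5) := Fin.castSucc_ne_last
  simp [axisPoint, h]

theorem preimage_meridian_axisDisk {lam : ℝ} (hlam : 0 ≤ lam) (z : ℝ) :
    meridian ⁻¹' axisDisk lam z = axisBall lam z := by
  ext X
  rw [axisBall, mem_ball_iff_norm, ← sq_lt_sq₀ (norm_nonneg _) hlam, norm_sub_axisPoint_sq]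
  rfl

theorem measurableSet_axisDisk (lam z : ℝ) : MeasurableSet (axisDisk lam z) :=
  measurableSet_lt (by fun_prop) (by fun_prop)

theorem memLp_lift {g : ℝ × ℝ → ℝ} (hg : MemLp g 2 mu5) : MemLp (lift g) 2 := by
  have h := (hg.smul_measure sphereArea_ne_top).comp_measurePreserving measurePreserving_meridian
  exact h.ofReal

theorem setLIntegral_lift {g : ℝ × ℝ → ℝ} (hg : MemLp g 2 mu5) {lam : ℝ} (hlam : 0 ≤ lam) (z : ℝ) :
    ∫⁻ X in axisBall lam z, ‖lift g X‖ₑ ^ 2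
      = sphereArea * ∫⁻ p in axisDisk lam z, ‖g p‖ₑ ^ 2 ∂mu5 := by
  have hm : AEMeasurable ((axisDisk lam z).indicator fun p => ‖g p‖ₑ ^ 2) (sphereArea • mu5) :=
    ((hg.1.enorm.pow_const 2).indicator (measurableSet_axisDisk lam z)).smul_measure _
  rw [← lintegral_indicator (measurableSet_axisDisk lam z), ← smul_eq_mul,
    ← lintegral_smul_measure, ← measurePreserving_meridian.map_eq, lintegral_map'
    (by rwa [measurePreserving_meridian.map_eq]) measurePreserving_meridian.aemeasurable,
    ← lintegral_indicator (show MeasurableSet (axisBall lam z) from measurableSet_ball)]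
  congr 1 with X
  have : X ∈ axisBall lam z ↔ meridian X ∈ axisDisk lam z := by
    rw [← preimage_meridian_axisDisk hlam]; rfl
  by_cases h : X ∈ axisBall lam z
  · rw [indicator_of_mem h, indicator_of_mem (this.1 h)]
    simp [lift, meridian, ← ofReal_norm]
  · rw [indicator_of_notMem h, indicator_of_notMem (this.not.1 h)]

end Meridian

/-! ### Mass of the profile in large axis disks. -/

section Mass

variable {S : Set ℤ} {g : ℝ × ℝ → ℝ} {k₀ k : ℤ}

theorem axisDisk_mass_le_of_mem {j : ℤ} (hj : j ∈ S) (z : ℝ) :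
    ∫⁻ p in axisDisk ((2 : ℝ) ^ (-j)) z, ‖g p‖ₑ ^ 2 ∂mu5
      ≤ ENNReal.ofReal ((2 : ℝ) ^ (-(4 * j))) * singularMass S g := by
  have h : ENNReal.ofReal ((2 : ℝ) ^ (4 * j)) *
      ∫⁻ p in axisDisk ((2 : ℝ) ^ (-j)) z, ‖g p‖ₑ ^ 2 ∂mu5 ≤ singularMass S g :=
    le_iSup₂_of_le j hj (le_iSup_of_le z le_rfl)
  refine le_trans (le_of_eq ?_) (mul_le_mul_right h _)
  rw [← mul_assoc, ← ENNReal.ofReal_mul (by positivity), ← zpow_add₀ two_ne_zero,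
    neg_add_cancel, zpow_zero, ENNReal.ofReal_one, one_mul]

theorem abs_lt_of_mem_axisDisk {R z : ℝ} (hR : 0 < R) {p : ℝ × ℝ} (hp : p ∈ axisDisk R z) :
    |p.2 - z| < R := by
  have h : p.1 ^ 2 + (p.2 - z) ^ 2 < R ^ 2 := hp
  exact abs_lt_of_sq_lt_sq (by nlinarith [sq_nonneg p.1]) hR.le

/-- A long axis disk meets the proximal cylinder in boundedly many lattice disks per unit length. -/
theorem axisDisk_mass_le_of_isProximal (hg : AEMeasurable g mu5) (hp : IsProximal k₀ g)
    {B : ℝ≥0∞} (n : ℕ) (hB : ∀ z, ∫⁻ p in axisDisk ((2 : ℝ) ^ (-k₀)) z, ‖g p‖ₑ ^ 2 ∂mu5 ≤ B)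
    (z : ℝ) :
    ∫⁻ p in axisDisk ((2 : ℝ) ^ n * (2 : ℝ) ^ (-k₀)) z, ‖g p‖ₑ ^ 2 ∂mu5 ≤ 5 * 2 ^ n * B := by
  set ρ : ℝ := (2 : ℝ) ^ (-k₀)
  have hρ : 0 < ρ := by positivity
  have hR : 0 < (2 : ℝ) ^ n * ρ := by positivity
  -- A lattice disk meeting the long disk has `|iρ - z| < (2^n + 1)ρ`; there are at most `2 * 2^n +
  -- 3 ≤ 5 * 2^n` such `i`.
  set F : Finset ℤ := Finset.Icc ⌈z / ρ - 2 ^ n - 1⌉ ⌊z / ρ + 2 ^ n + 1⌋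
  have hcard : (F.card : ℝ≥0∞) ≤ 5 * 2 ^ n := by
    have h1 : F.card ≤ 5 * 2 ^ n := by
      rw [Int.card_Icc, Int.toNat_le]
      have h2 := Int.floor_le (z / ρ + 2 ^ n + 1)
      have h3 := Int.le_ceil (z / ρ - 2 ^ n - 1)
      have h4 : (1 : ℝ) ≤ 2 ^ n := one_le_pow₀ (by norm_num)
      have : ((⌊z / ρ + 2 ^ n + 1⌋ + 1 - ⌈z / ρ - 2 ^ n - 1⌉ : ℤ) : ℝ)
          ≤ ((5 * 2 ^ n : ℕ) : ℤ) := by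
        push_cast
        linarith
      exact_mod_cast this
    calc (F.card : ℝ≥0∞) ≤ ((5 * 2 ^ n : ℕ) : ℝ≥0∞) := by exact_mod_cast h1
      _ = 5 * 2 ^ n := by push_cast; rfl
  have hmem : ∀ i : ℤ, ∀ p ∈ axisDisk (2 ^ n * ρ) z, p ∈ axisDisk ρ (i * ρ) → i ∈ F := by
    intro i p hp1 hp2
    have h1 := abs_lt.1 (abs_lt_of_mem_axisDisk hR hp1)
    have h2 := abs_lt.1 (abs_lt_of_mem_axisDisk hρ hp2)
    rw [Finset.mem_Icc, Int.ceil_le, Int.le_floor]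
    have hz : z / ρ * ρ = z := div_mul_cancel₀ z hρ.ne'
    constructor
    · refine le_of_mul_le_mul_right ?_ hρ
      rw [sub_mul, sub_mul, hz]
      linarith
    · refine le_of_mul_le_mul_right ?_ hρ
      rw [add_mul, add_mul, hz]
      linarith
  rw [← lintegral_indicator (measurableSet_axisDisk _ _)]
  calc _ ≤ ∫⁻ p, ∑ i ∈ F, (axisDisk ρ (i * ρ)).indicator (fun p => ‖g p‖ₑ ^ 2) p ∂mu5 := by
        refine lintegral_mono_ae ?_
        filter_upwards [hp] with p hp
        by_cases hp1 : p ∈ axisDisk (2 ^ n * ρ) z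
        · rw [indicator_of_mem hp1]
          by_cases hp2 : p ∈ ⋃ i : ℤ, axisDisk ρ (i * ρ)
          · obtain ⟨i, hi⟩ := mem_iUnion.1 hp2
            have := Finset.single_le_sum (f := fun i : ℤ =>
              (axisDisk ρ (i * ρ)).indicator (fun p => ‖g p‖ₑ ^ 2) p) (fun _ _ => zero_le)
              (hmem i p hp1 hi)
            refine le_trans (le_of_eq ?_) this
            rw [indicator_of_mem hi]
          · rw [hp hp2]
            simp
        · rw [indicator_of_notMem hp1]
          exact zero_le
    _ = ∑ i ∈ F, ∫⁻ p in axisDisk ρ (i * ρ), ‖g p‖ₑ ^ 2 ∂mu5 := by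
        rw [lintegral_finsetSum' _ fun i _ =>
          (hg.enorm.pow_const 2).indicator (measurableSet_axisDisk _ _)]
        exact Finset.sum_congr rfl fun i _ => lintegral_indicator (measurableSet_axisDisk _ _) _
    _ ≤ F.card * B := by
        rw [← nsmul_eq_mul]
        exact Finset.sum_le_card_nsmul _ _ _ fun i _ => hB _
    _ ≤ _ := by gcongr

/-- Scaling-critical mass bound for all axis disks of radius at least `2^{-k}`. -/
theorem axisDisk_mass_le (hg : AEMeasurable g mu5) (hk : k₀ ≤ k) (hS : Icc k₀ k ⊆ S)
    (hp : IsProximal k₀ g) (n : ℕ) (z : ℝ) :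
    ∫⁻ p in axisDisk ((2 : ℝ) ^ n * (2 : ℝ) ^ (-k)) z, ‖g p‖ₑ ^ 2 ∂mu5
      ≤ 5 * (ENNReal.ofReal ((2 : ℝ) ^ (-(4 * k))) * singularMass S g) * 32 ^ n := by
  have h32 : (32 : ℝ≥0∞) ^ n = ENNReal.ofReal (32 ^ n) := by
    rw [ENNReal.ofReal_pow (by norm_num)]; norm_num
  -- If the radius is at most `2^(-k₀)`, its exponent `k - n` lies in `S`; the growth is then
  -- `16^n`, weakened to `32^n` to match the volume.
  by_cases hn : k₀ ≤ k - n
  · have h := axisDisk_mass_le_of_mem (g := g) (hS ⟨hn, by lia⟩) z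
    have e : (2 : ℝ) ^ (-(k - n : ℤ)) = 2 ^ n * 2 ^ (-k) := by
      rw [← zpow_natCast, ← zpow_add₀ two_ne_zero]; ring_nf
    rw [e] at h
    refine h.trans ?_
    have h2 : ENNReal.ofReal ((2 : ℝ) ^ (-(4 * (k - n : ℤ))))
        ≤ 5 * ENNReal.ofReal ((2 : ℝ) ^ (-(4 * k))) * 32 ^ n := by
      rw [h32, show (5 : ℝ≥0∞) = ENNReal.ofReal 5 by norm_num, ← ENNReal.ofReal_mul (by norm_num),
        ← ENNReal.ofReal_mul (by positivity)]
      refine ENNReal.ofReal_le_ofReal ?_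
      rw [show -(4 * (k - n : ℤ)) = -(4 * k) + 4 * n by ring, zpow_add₀ two_ne_zero, zpow_mul,
        zpow_natCast]
      have : ((2 : ℝ) ^ (4 : ℤ)) ^ n ≤ 32 ^ n := by gcongr; norm_num
      have h0 : (0 : ℝ) < 2 ^ (-(4 * k)) := by positivity
      nlinarith [mul_le_mul_of_nonneg_left this h0.le, mul_pos h0 (pow_pos (by norm_num : (0 : ℝ) < 32) n)]
    calc _ ≤ (5 * ENNReal.ofReal ((2 : ℝ) ^ (-(4 * k))) * 32 ^ n) * singularMass S g := by gcongr
      _ = _ := by ring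
  -- Now the radius is `2^l 2^(-k₀)` with `n = l + d` and `d = k - k₀`. The covering costs `2^l`,
  -- the change of scale `16^d`, and `2^l 16^d ≤ 32^n`.
  · obtain ⟨l, hl⟩ : ∃ l : ℕ, (n : ℤ) = l + (k - k₀) := ⟨(n - (k - k₀)).toNat, by lia⟩
    obtain ⟨d, hd⟩ : ∃ d : ℕ, (d : ℤ) = k - k₀ := ⟨(k - k₀).toNat, by lia⟩
    have hnl : n = l + d := by lia
    have e : (2 : ℝ) ^ n * 2 ^ (-k) = 2 ^ l * 2 ^ (-k₀) := by
      rw [← zpow_natCast, ← zpow_natCast, ← zpow_add₀ two_ne_zero, ← zpow_add₀ two_ne_zero]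
      congr 1
      lia
    rw [e]
    refine (axisDisk_mass_le_of_isProximal hg hp l
      (axisDisk_mass_le_of_mem (hS ⟨le_rfl, hk⟩)) z).trans ?_
    have h2 : 2 ^ l * ENNReal.ofReal ((2 : ℝ) ^ (-(4 * k₀)))
        ≤ ENNReal.ofReal ((2 : ℝ) ^ (-(4 * k))) * 32 ^ n := by
      rw [h32, show (2 : ℝ≥0∞) ^ l = ENNReal.ofReal (2 ^ l) by
        rw [ENNReal.ofReal_pow (by norm_num)]; norm_num, ← ENNReal.ofReal_mul (by positivity),
        ← ENNReal.ofReal_mul (by positivity)]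
      refine ENNReal.ofReal_le_ofReal ?_
      rw [show -(4 * k₀) = -(4 * k) + 4 * d by lia, zpow_add₀ two_ne_zero, zpow_mul _ 4,
        zpow_natCast, hnl, pow_add, mul_left_comm]
      have h3 : ((2 : ℝ) ^ (4 : ℤ)) ^ d ≤ 32 ^ d := by gcongr; norm_num
      have h4 : (2 : ℝ) ^ l ≤ 32 ^ l := by gcongr; norm_num
      gcongr
    calc _ = 5 * (2 ^ l * ENNReal.ofReal ((2 : ℝ) ^ (-(4 * k₀)))) * singularMass S g := by ring
      _ ≤ 5 * (ENNReal.ofReal ((2 : ℝ) ^ (-(4 * k))) * 32 ^ n) * singularMass S g := by gcongr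
      _ = _ := by ring

end Mass

/-! ### Weighted integrals by dyadic balls. -/

section Weight

/-- The polynomial weight at scale `a⁻¹` centred at `X`. -/
noncomputable def weight (a : ℝ) (X Y : R5) : ℝ≥0∞ :=
  ENNReal.ofReal ((1 + a * ‖X - Y‖) ^ 6)⁻¹

theorem measurable_weight (a : ℝ) (X : R5) : Measurable (weight a X) := by
  unfold weight
  fun_prop

/-- If `n` is least with `Y` in the ball of radius `2^n a⁻¹`, the weight at `Y` is at most `64 *
64^(-n)`. Against growth `32^n` this leaves `64 A ∑ 2^(-n) = 128 A`. A general measure is allowed so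
that both volume and `|G|²` fit. -/
theorem lintegral_weight_le {μ : Measure R5} {P X : R5} {a : ℝ} (ha : 0 < a) {A : ℝ≥0∞}
    (hμ : ∀ n : ℕ, μ (Metric.ball P (2 ^ n * a⁻¹)) ≤ A * 32 ^ n) (hX : X ∈ Metric.ball P a⁻¹) :
    ∫⁻ Y, weight a X Y ∂μ ≤ 128 * A := by
  have hXP : a * ‖X - P‖ < 1 := by
    rw [mem_ball_iff_norm] at hX
    calc a * ‖X - P‖ < a * a⁻¹ := by gcongr
      _ = 1 := mul_inv_cancel₀ ha.ne'
  have hpt : ∀ Y, weight a X Y ≤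
      ∑' n : ℕ, (Metric.ball P (2 ^ n * a⁻¹)).indicator (fun _ => 64 * (64 : ℝ≥0∞)⁻¹ ^ n) Y := by
    intro Y
    have hex : ∃ n : ℕ, a * ‖Y - P‖ < 2 ^ n := pow_unbounded_of_one_lt _ (by norm_num)
    classical
    set n := Nat.find hex with hn
    have hY : Y ∈ Metric.ball P (2 ^ n * a⁻¹) := by
      rw [mem_ball_iff_norm, ← div_eq_mul_inv, lt_div_iff₀ ha, mul_comm]
      exact Nat.find_spec hex
    refine le_trans ?_ (ENNReal.le_tsum n)
    rw [indicator_of_mem hY]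
    have htri : ‖Y - P‖ ≤ ‖X - P‖ + ‖X - Y‖ := by
      rw [← norm_sub_rev Y X, ← sub_add_sub_cancel Y X P, add_comm]
      exact norm_add_le _ _
    have hge : a * ‖Y - P‖ ≤ 1 + a * ‖X - Y‖ := by
      nlinarith [mul_le_mul_of_nonneg_left htri ha.le]
    have h0 : 0 ≤ a * ‖X - Y‖ := by positivity
    rcases hnn : n with _ | m
    · rw [pow_zero, mul_one, weight]
      calc _ ≤ ENNReal.ofReal 1 := by
            refine ENNReal.ofReal_le_ofReal (inv_le_one_of_one_le₀ (one_le_pow₀ (by linarith)))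
        _ ≤ 64 := by norm_num
    -- With `n = m + 1`, minimality gives `2^m ≤ a‖Y - P‖`, whose sixth power is `64^m`; the shift
    -- by one explains the prefactor `64`.
    · have hm : (2 : ℝ) ^ m ≤ a * ‖Y - P‖ := not_lt.1
        (Nat.find_min hex (show m < Nat.find hex by rw [← hn, hnn]; exact m.lt_succ_self))
      rw [pow_succ', ← mul_assoc, ENNReal.mul_inv_cancel (by norm_num) (by norm_num), one_mul,
        weight]
      calc _ ≤ ENNReal.ofReal ((64 : ℝ)⁻¹ ^ m) := by
            refine ENNReal.ofReal_le_ofReal ?_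
            rw [inv_pow]
            refine inv_anti₀ (by positivity) ?_
            calc (64 : ℝ) ^ m = (2 ^ m) ^ 6 := by rw [← pow_mul, mul_comm, pow_mul]; norm_num
              _ ≤ _ := by gcongr; exact hm.trans hge
        _ = _ := by
            rw [ENNReal.ofReal_pow (by norm_num), ENNReal.ofReal_inv_of_pos (by norm_num)]
            norm_num
  calc _ ≤ ∫⁻ Y, ∑' n : ℕ, (Metric.ball P (2 ^ n * a⁻¹)).indicator
          (fun _ => 64 * (64 : ℝ≥0∞)⁻¹ ^ n) Y ∂μ := lintegral_mono hpt
    _ = ∑' n : ℕ, 64 * (64 : ℝ≥0∞)⁻¹ ^ n * μ (Metric.ball P (2 ^ n * a⁻¹)) := by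
        rw [lintegral_tsum fun n => (measurable_const.indicator measurableSet_ball).aemeasurable]
        simp_rw [lintegral_indicator_const measurableSet_ball]
    _ ≤ ∑' n : ℕ, 64 * A * (2⁻¹ : ℝ≥0∞) ^ n := by
        refine ENNReal.tsum_le_tsum fun n => ?_
        calc _ ≤ 64 * (64 : ℝ≥0∞)⁻¹ ^ n * (A * 32 ^ n) := by gcongr; exact hμ n
          _ = 64 * A * ((64 : ℝ≥0∞)⁻¹ * 32) ^ n := by rw [mul_pow]; ring
          _ = _ := by
            congr 2
            rw [show (64 : ℝ≥0∞) = 2 * 32 by norm_num, ENNReal.mul_inv (by norm_num) (by norm_num),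
              mul_assoc, ENNReal.inv_mul_cancel (by norm_num) (by norm_num), mul_one]
    _ = 128 * A := by
        rw [ENNReal.tsum_mul_left, ENNReal.tsum_geometric, ENNReal.one_sub_inv_two, inv_inv]
        ring_nf

/-- Cauchy-Schwarz for the measure `w dY`, applied to `|G|` and `1`. The factors are integrals of
`w` against `|G|² dY` and `dY`. -/
theorem lintegral_weight_mul_le {P X : R5} {a : ℝ} (ha : 0 < a) (hX : X ∈ Metric.ball P a⁻¹)
    {G : R5 → ℂ} (hG : AEMeasurable G) {A B : ℝ≥0∞}
    (hA : ∀ n : ℕ, volume (Metric.ball P (2 ^ n * a⁻¹)) ≤ A * 32 ^ n)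
    (hB : ∀ n : ℕ, ∫⁻ Y in Metric.ball P (2 ^ n * a⁻¹), ‖G Y‖ₑ ^ 2 ≤ B * 32 ^ n) :
    ∫⁻ Y, weight a X Y * ‖G Y‖ₑ ≤ (128 * B) ^ (1 / 2 : ℝ) * (128 * A) ^ (1 / 2 : ℝ) := by
  have hw := measurable_weight a X
  have hG2 : AEMeasurable fun Y => ‖G Y‖ₑ ^ 2 := hG.enorm.pow_const 2
  have hGw : AEMeasurable (fun Y => ‖G Y‖ₑ) (volume.withDensity (weight a X)) :=
    hG.enorm.mono_ac (withDensity_absolutelyContinuous _ _)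
  have h := ENNReal.lintegral_mul_le_Lp_mul_Lq (volume.withDensity (weight a X))
    Real.HolderConjugate.two_two hGw (aemeasurable_const (b := (1 : ℝ≥0∞)))
  simp only [Pi.mul_apply, mul_one] at h
  have e1 : ∫⁻ Y, ‖G Y‖ₑ ∂(volume.withDensity (weight a X)) = ∫⁻ Y, weight a X Y * ‖G Y‖ₑ := by
    rw [lintegral_withDensity_eq_lintegral_mul₀ hw.aemeasurable hG.enorm]
    rfl
  have e2 : ∫⁻ Y, ‖G Y‖ₑ ^ (2 : ℝ) ∂(volume.withDensity (weight a X)) ≤ 128 * B := by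
    simp only [ENNReal.rpow_ofNat]
    rw [lintegral_withDensity_eq_lintegral_mul₀ hw.aemeasurable hG2]
    calc _ = ∫⁻ Y, weight a X Y ∂(volume.withDensity fun Y => ‖G Y‖ₑ ^ 2) := by
          rw [lintegral_withDensity_eq_lintegral_mul₀ hG2 hw.aemeasurable, mul_comm]
      _ ≤ _ := lintegral_weight_le ha
          (fun n => by rw [withDensity_apply _ measurableSet_ball]; exact hB n) hX
  have e3 : ∫⁻ _, (1 : ℝ≥0∞) ^ (2 : ℝ) ∂(volume.withDensity (weight a X)) ≤ 128 * A := by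
    rw [ENNReal.one_rpow, lintegral_one, withDensity_apply _ MeasurableSet.univ,
      Measure.restrict_univ]
    exact lintegral_weight_le ha hA hX
  rw [e1] at h
  exact h.trans (by gcongr)

end Weight

/-! ### Calculus of local block bounds. -/

section LocalBound

/-- Smooth compactly supported bumps vanishing near the frequency origin. -/
structure IsAnnularBump (η : R5 → ℂ) : Prop where
  contDiff : ContDiff ℝ ∞ η
  hasCompactSupport : HasCompactSupport η
  zero_notMem : (0 : R5) ∉ tsupport η

/-- The convolution kernel with multiplier `η(2^{-k} ξ)`. -/
noncomputable def dyadicKernel (η : R5 → ℂ) (k : ℤ) : R5 → ℂ :=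
  𝓕⁻ fun ξ => η (((2 : ℝ) ^ k)⁻¹ • ξ)

/-- Operators on fields, indexed by dyadic scales, whose values on the ball `B_{2^{-k}}(z)` are at
most `C √δ 2^{e k}` for all proximal lifted fields. -/
def LocalBound (e : ℝ) (T : (R5 → ℂ) → ℤ → R5 → ℂ) : Prop :=
  ∃ C : ℝ≥0, ∀ (S : Set ℤ) (g : ℝ × ℝ → ℝ) (k₀ k : ℤ) (z : ℝ),
    MemLp g 2 mu5 → k₀ ≤ k → Icc k₀ k ⊆ S → IsProximal k₀ g →
    ∀ X ∈ axisBall ((2 : ℝ) ^ (-k)) z, ‖T (lift g) k X‖ₑ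
      ≤ C * singularMass S g ^ (1 / 2 : ℝ) * ENNReal.ofReal ((2 : ℝ) ^ (e * k))

variable {e : ℝ} {T T' : (R5 → ℂ) → ℤ → R5 → ℂ}

theorem LocalBound.add (h : LocalBound e T) (h' : LocalBound e T') :
    LocalBound e fun G k X => T G k X + T' G k X := by
  obtain ⟨C, hC⟩ := h
  obtain ⟨C', hC'⟩ := h'
  refine ⟨C + C', fun S g k₀ k z hg hk hS hp X hX => (enorm_add_le _ _).trans ?_⟩
  rw [ENNReal.coe_add, add_mul, add_mul]
  exact add_le_add (hC S g k₀ k z hg hk hS hp X hX) (hC' S g k₀ k z hg hk hS hp X hX)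

theorem LocalBound.const_mul (h : LocalBound e T) (c : ℂ) :
    LocalBound e fun G k X => c * T G k X := by
  obtain ⟨C, hC⟩ := h
  refine ⟨‖c‖₊ * C, fun S g k₀ k z hg hk hS hp X hX => ?_⟩
  rw [enorm_mul, ENNReal.coe_mul, mul_assoc, mul_assoc, ← mul_assoc (C : ℝ≥0∞)]
  exact mul_le_mul_right (hC S g k₀ k z hg hk hS hp X hX) _

theorem LocalBound.sum {ι : Type*} {T : ι → (R5 → ℂ) → ℤ → R5 → ℂ} (s : Finset ι)
    (h : ∀ i, LocalBound e (T i)) : LocalBound e fun G k X => ∑ i ∈ s, T i G k X := by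
  classical
  induction s using Finset.induction_on with
  | empty => exact ⟨0, fun _ _ _ _ _ _ _ _ _ _ _ => by simp⟩
  | insert a s ha ih =>
    simp only [Finset.sum_insert ha]
    exact (h a).add ih

/-- Serves both for a radial coordinate `X_i` near the axis and for the scalar `2^(-k)` of the
commutator. -/
theorem LocalBound.mul_of_norm_le (h : LocalBound e T) {f : ℤ → R5 → ℂ}
    (hf : ∀ k z, ∀ X ∈ axisBall ((2 : ℝ) ^ (-k)) z, ‖f k X‖ ≤ (2 : ℝ) ^ (-k)) :
    LocalBound (e - 1) fun G k X => f k X * T G k X := by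
  obtain ⟨C, hC⟩ := h
  refine ⟨C, fun S g k₀ k z hg hk hS hp X hX => ?_⟩
  have h1 : ‖f k X‖ₑ ≤ ENNReal.ofReal ((2 : ℝ) ^ (-k)) := by
    rw [← ofReal_norm]
    exact ENNReal.ofReal_le_ofReal (hf k z X hX)
  have h2 : ENNReal.ofReal ((2 : ℝ) ^ ((e - 1) * k))
      = ENNReal.ofReal ((2 : ℝ) ^ (-k)) * ENNReal.ofReal ((2 : ℝ) ^ (e * k)) := by
    rw [← ENNReal.ofReal_mul (by positivity), ← Real.rpow_intCast, ← Real.rpow_add two_pos]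
    push_cast
    ring_nf
  rw [enorm_mul, h2, mul_left_comm]
  exact mul_le_mul' h1 (hC S g k₀ k z hg hk hS hp X hX)

theorem coe_norm_castSucc_le {k : ℤ} {z : ℝ} {X : R5} (hX : X ∈ axisBall ((2 : ℝ) ^ (-k)) z)
    (i : Fin 4) : ‖(X i.castSucc : ℂ)‖ ≤ (2 : ℝ) ^ (-k) := by
  have h := PiLp.norm_apply_le (X - axisPoint z) i.castSucc
  have h0 : (X - axisPoint z) i.castSucc = X i.castSucc := by
    have h : i.castSucc ≠ (4 : Fin 5) := Fin.castSucc_ne_last i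
    simp [axisPoint, h]
  rw [h0] at h
  rw [Complex.norm_real]
  exact h.trans (mem_ball_iff_norm.1 hX).le

end LocalBound

/-! ### The scalar block estimate. -/

section Kernel

variable {η m : R5 → ℂ} {s : ℝ}

theorem dyadicKernel_eq (η : R5 → ℂ) (k : ℤ) (X : R5) :
    dyadicKernel η k X = (((2 : ℝ) ^ (5 * k) : ℝ) : ℂ) * 𝓕⁻ η ((2 : ℝ) ^ k • X) := by
  rw [dyadicKernel, fourierInv_comp_inv_smul η (by positivity), finrank_euclideanSpace_fin,
    ← zpow_natCast, ← zpow_mul, mul_comm k]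
  rfl

theorem lpKernel_eq_dyadicKernel (ψ : R5 → ℝ) (k : ℤ) :
    lpKernel ψ k = dyadicKernel (fun ξ => (ψ ξ : ℂ)) k := by
  ext X
  rw [dyadicKernel_eq, lpKernel]

theorem IsLittlewoodPaley.isAnnularBump {ψ : R5 → ℝ} (hψ : IsLittlewoodPaley ψ) :
    IsAnnularBump fun ξ => (ψ ξ : ℂ) where
  contDiff := Complex.ofRealCLM.contDiff.comp hψ.contDiff
  hasCompactSupport := hψ.hasCompactSupport.comp_left Complex.ofReal_zero
  zero_notMem h := hψ.zero_notMem
    (tsupport_comp_subset Complex.ofReal_zero ψ h)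

/-- Multiplication of the kernel by a coordinate differentiates the bump. -/
theorem IsAnnularBump.exists_coord_mul (hη : IsAnnularBump η) (i : Fin 5) :
    ∃ η' : R5 → ℂ, IsAnnularBump η' ∧ ∀ X : R5, (X i : ℂ) * 𝓕⁻ η X = 𝓕⁻ η' X := by
  let f : SchwartzMap R5 ℂ := hη.hasCompactSupport.toSchwartzMap hη.contDiff
  let v : R5 := EuclideanSpace.single i 1
  let f' : SchwartzMap R5 ℂ := (-(2 * Real.pi * Complex.I))⁻¹ • LineDeriv.lineDerivOp v f
  -- Differentiation does not enlarge the support, so the new bump is still annular.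
  have hsub : tsupport f' ⊆ tsupport η :=
    (closure_mono (Function.support_const_smul_subset _ _)).trans
      (SchwartzMap.tsupport_lineDerivOp_subset v f)
  refine ⟨f', ⟨f'.smooth ⊤, hη.hasCompactSupport.of_isClosed_subset (isClosed_tsupport _) hsub,
    fun h => hη.zero_notMem (hsub h)⟩, fun X => ?_⟩
  have hg : (inner ℝ · v : R5 → ℝ).HasTemperateGrowth := by fun_prop
  have h1 : 𝓕⁻ f' X = (-(2 * Real.pi * Complex.I))⁻¹ * 𝓕⁻ (LineDeriv.lineDerivOp v f) X := by
    simp only [f']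
    rw [FourierTransform.fourierInv_smul]
    rfl
  rw [← SchwartzMap.fourierInv_coe, h1, SchwartzMap.fourierInv_lineDerivOp_eq]
  have hI : (2 * Real.pi * Complex.I : ℂ) ≠ 0 := Complex.two_pi_I_ne_zero
  have h2 : 𝓕⁻ f X = 𝓕⁻ η X := by rw [SchwartzMap.fourierInv_coe]; rfl
  rw [smul_apply, SchwartzMap.smulLeftCLM_apply_apply hg, h2, smul_eq_mul,
    inv_mul_cancel_left₀ (neg_ne_zero.2 hI), Complex.real_smul]
  simp [v, EuclideanSpace.inner_single_right]

theorem IsAnnularBump.dilate (hη : IsAnnularBump η) (k : ℤ) :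
    ContDiff ℝ ∞ (fun ξ => η (((2 : ℝ) ^ k)⁻¹ • ξ)) ∧
      HasCompactSupport fun ξ => η (((2 : ℝ) ^ k)⁻¹ • ξ) :=
  ⟨hη.contDiff.comp (contDiff_const_smul _),
    hη.hasCompactSupport.comp_smul (by positivity)⟩

theorem IsAnnularBump.integrable_dyadicKernel_mul (hη : IsAnnularBump η)
    (hm : IsSymbolOfOrder s m) (hs : -(5 / 2) < s) (hs0 : s ≤ 0) (G : R5 → ℂ) (k : ℤ) (X : R5) :
    Integrable fun Y => dyadicKernel η k (X - Y) * multiplierOp m G Y :=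
  integrable_fourierInv_sub_mul_multiplierOp (hη.dilate k).1 (hη.dilate k).2
    (hm.isAdmissible hs hs0 G) X

theorem volume_ball_pow_le (P : R5) (k : ℤ) (n : ℕ) :
    volume (Metric.ball P (2 ^ n * ((2 : ℝ) ^ k)⁻¹))
      ≤ ENNReal.ofReal ((2 : ℝ) ^ (-(5 * k))) * volume (Metric.ball (0 : R5) 1) * 32 ^ n := by
  rw [Measure.addHaar_ball _ _ (by positivity), finrank_euclideanSpace_fin, mul_pow,
    ENNReal.ofReal_mul (by positivity), ← pow_mul, mul_comm n, pow_mul,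
    ENNReal.ofReal_pow (by norm_num), inv_pow, ← zpow_natCast ((2 : ℝ) ^ k), ← zpow_mul,
    ← zpow_neg, mul_comm k]
  norm_num
  exact le_of_eq (by ring)

/-- Power counting: kernel height `2^((5+s)k)`, root of the mass `2^(-2k)`, root of the volume
`2^(-5k/2)`. -/
theorem two_zpow_rpow_identity (s : ℝ) (k : ℤ) :
    ((2 : ℝ) ^ k) ^ 5 * ((2 : ℝ) ^ k) ^ s *
      (((2 : ℝ) ^ (-(4 * k))) ^ (1 / 2 : ℝ) * ((2 : ℝ) ^ (-(5 * k))) ^ (1 / 2 : ℝ))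
      = (2 : ℝ) ^ ((s + 1 / 2) * k) := by
  simp only [← Real.rpow_intCast, ← Real.rpow_natCast, ← Real.rpow_mul two_pos.le,
    ← Real.rpow_add two_pos]
  push_cast
  ring_nf

/-- The block estimate for a scalar multiplier of order `s`. -/
theorem IsAnnularBump.localBound (hη : IsAnnularBump η) (hm : IsSymbolOfOrder s m)
    (hs : -(5 / 2) < s) (hs0 : s ≤ 0) :
    LocalBound (s + 1 / 2) fun G k X =>
      ∫ Y, dyadicKernel η k (X - Y) * multiplierOp m G Y := by
  obtain ⟨C, hC0, hC⟩ := hm.exists_kernel_bound hη.contDiff hη.hasCompactSupport hη.zero_notMem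
  set V := volume (Metric.ball (0 : R5) 1)
  have hV : V ≠ ⊤ := measure_ball_lt_top.ne
  set D : ℝ≥0∞ := ENNReal.ofReal C * ((128 * (sphereArea * 5)) ^ (1 / 2 : ℝ) *
    (128 * V) ^ (1 / 2 : ℝ))
  have hD : D ≠ ⊤ := by
    refine ENNReal.mul_ne_top ENNReal.ofReal_ne_top (ENNReal.mul_ne_top ?_ ?_)
    · exact ENNReal.rpow_ne_top_of_nonneg (by norm_num) (ENNReal.mul_ne_top (by norm_num)
        (ENNReal.mul_ne_top sphereArea_ne_top (by norm_num)))
    · exact ENNReal.rpow_ne_top_of_nonneg (by norm_num) (ENNReal.mul_ne_top (by norm_num) hV)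
  refine ⟨D.toNNReal, fun S g k₀ k z hg hk hS hp X hX => ?_⟩
  rw [ENNReal.coe_toNNReal hD]
  set a : ℝ := (2 : ℝ) ^ k with ha_def
  have ha : 0 < a := by positivity
  have hinv : (2 : ℝ) ^ (-k) = a⁻¹ := zpow_neg _ _
  have hG := memLp_lift hg
  set δ := singularMass S g
  have hηm : ContDiff ℝ ∞ fun ξ => η (a⁻¹ • ξ) * m ξ := by
    have := (hm.contDiff_mul_dilate hη.contDiff hη.zero_notMem ha).comp
      (contDiff_const_smul (a⁻¹ : ℝ))
    simpa only [Function.comp_def, smul_inv_smul₀ ha.ne'] using this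
  simp only [dyadicKernel]
  rw [integral_fourierInv_mul_multiplierOp (hη.dilate k).1 (hη.dilate k).2 hηm
    (hm.isAdmissible hs hs0 _) hG]
  have hmass : ∀ n : ℕ, ∫⁻ Y in Metric.ball (axisPoint z) (2 ^ n * a⁻¹), ‖lift g Y‖ₑ ^ 2
      ≤ sphereArea * (5 * (ENNReal.ofReal ((2 : ℝ) ^ (-(4 * k))) * δ)) * 32 ^ n := by
    intro n
    refine (setLIntegral_lift hg (by positivity) z).trans_le ?_
    rw [mul_assoc, ← hinv]
    exact mul_le_mul_right (axisDisk_mass_le hg.1.aemeasurable hk hS hp n z) _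
  have hX' : X ∈ Metric.ball (axisPoint z) a⁻¹ := by rw [← hinv]; exact hX
  have hW := lintegral_weight_mul_le ha hX' hG.1.aemeasurable
    (volume_ball_pow_le (axisPoint z) k) hmass
  calc _ ≤ ∫⁻ Y, ‖𝓕⁻ (fun ξ => η (a⁻¹ • ξ) * m ξ) (X - Y) * lift g Y‖ₑ :=
        enorm_integral_le_lintegral_enorm _
    _ ≤ ∫⁻ Y, ENNReal.ofReal (C * (a ^ 5 * a ^ s)) * (weight a X Y * ‖lift g Y‖ₑ) := by
        refine lintegral_mono fun Y => ?_
        rw [enorm_mul, ← mul_assoc]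
        refine mul_le_mul_left ?_ _
        rw [weight, ← ENNReal.ofReal_mul (by positivity), ← ofReal_norm]
        exact ENNReal.ofReal_le_ofReal (hC a ha (X - Y))
    _ = ENNReal.ofReal (C * (a ^ 5 * a ^ s)) * ∫⁻ Y, weight a X Y * ‖lift g Y‖ₑ :=
        lintegral_const_mul' _ _ ENNReal.ofReal_ne_top
    _ ≤ ENNReal.ofReal (C * (a ^ 5 * a ^ s)) *
          ((128 * (sphereArea * (5 * (ENNReal.ofReal ((2 : ℝ) ^ (-(4 * k))) * δ)))) ^ (1 / 2 : ℝ) *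
          (128 * (ENNReal.ofReal ((2 : ℝ) ^ (-(5 * k))) * V)) ^ (1 / 2 : ℝ)) := by gcongr
    _ = D * δ ^ (1 / 2 : ℝ) * ENNReal.ofReal ((2 : ℝ) ^ ((s + 1 / 2) * k)) := by
        have h2 : (0 : ℝ) ≤ 1 / 2 := by norm_num
        have h3 : ∀ x y : ℝ, 0 ≤ x → 0 ≤ y → ENNReal.ofReal (x ^ (1 / 2 : ℝ) * y ^ (1 / 2 : ℝ))
            = ENNReal.ofReal x ^ (1 / 2 : ℝ) * ENNReal.ofReal y ^ (1 / 2 : ℝ) := fun x y hx hy => by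
          rw [ENNReal.ofReal_mul (by positivity), ENNReal.ofReal_rpow_of_nonneg hx h2,
            ENNReal.ofReal_rpow_of_nonneg hy h2]
        rw [← two_zpow_rpow_identity, ← ha_def, ENNReal.ofReal_mul hC0,
          ENNReal.ofReal_mul (p := a ^ 5 * a ^ s) (by positivity),
          h3 _ _ (by positivity) (by positivity)]
        simp only [D, ENNReal.mul_rpow_of_nonneg _ _ h2]
        ring

end Kernel

/-! ### From components to vector fields. -/

section Vector

theorem enorm_euclideanSpace_le_sum (v : EuclideanSpace ℂ (Fin 5)) : ‖v‖ₑ ≤ ∑ i, ‖v i‖ₑ := by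
  conv_lhs => rw [← (EuclideanSpace.basisFun (Fin 5) ℂ).sum_repr v]
  refine (enorm_sum_le _ _).trans_eq (Finset.sum_congr rfl fun i _ => ?_)
  rw [enorm_smul, ← ofReal_norm ((EuclideanSpace.basisFun (Fin 5) ℂ) i),
    OrthonormalBasis.norm_eq_one, ENNReal.ofReal_one, mul_one, EuclideanSpace.basisFun_repr]

/-- A block bound for each component gives the block bound of the vector field. -/
theorem exists_eLpNorm_lpBlock_le {ψ : R5 → ℝ} {e : ℝ}
    {U : (R5 → ℂ) → R5 → EuclideanSpace ℂ (Fin 5)}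
    (hint : ∀ G k X i, Integrable fun Y => lpKernel ψ k (X - Y) * U G Y i)
    (hb : ∀ i, LocalBound e fun G k X => ∫ Y, lpKernel ψ k (X - Y) * U G Y i) :
    ∃ C : ℝ≥0, ∀ (S : Set ℤ) (g : ℝ × ℝ → ℝ) (k₀ k : ℤ) (z : ℝ),
      MemLp g 2 mu5 → k₀ ≤ k → Icc k₀ k ⊆ S → IsProximal k₀ g →
      eLpNorm ((axisBall ((2 : ℝ) ^ (-k)) z).indicator (lpBlock ψ k (U (lift g)))) ⊤ volume
        ≤ C * singularMass S g ^ (1 / 2 : ℝ) * ENNReal.ofReal ((2 : ℝ) ^ (e * k)) := by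
  choose C hC using hb
  refine ⟨∑ i, C i, fun S g k₀ k z hg hk hS hp => ?_⟩
  rw [eLpNorm_exponent_top]
  refine eLpNormEssSup_le_of_ae_enorm_bound (.of_forall fun X => ?_)
  by_cases hX : X ∈ axisBall ((2 : ℝ) ^ (-k)) z
  · rw [indicator_of_mem hX]
    refine (enorm_euclideanSpace_le_sum _).trans ?_
    rw [ENNReal.ofNNReal_finsetSum, Finset.sum_mul, Finset.sum_mul]
    refine Finset.sum_le_sum fun i _ => ?_
    -- The Bochner integral may be evaluated componentwise because every component is integrable,
    -- which is the role of `hint`.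
    have h : lpBlock ψ k (U (lift g)) X i = ∫ Y, lpKernel ψ k (X - Y) * U (lift g) Y i :=
      eval_integral_piLp (f := fun Y => lpKernel ψ k (X - Y) • U (lift g) Y)
        (fun i => hint (lift g) k X i) i
    rw [h]
    exact hC i S g k₀ k z hg hk hS hp X hX
  · rw [indicator_of_notMem hX, enorm_zero]
    exact zero_le

end Vector

/-! ### Commuting coordinates with blocks. -/

section Coordinate

variable {η η' m : R5 → ℂ} {s : ℝ}

theorem coord_mul_dyadicKernel {i : Fin 5} (h : ∀ X : R5, (X i : ℂ) * 𝓕⁻ η X = 𝓕⁻ η' X) (k : ℤ)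
    (X : R5) : (X i : ℂ) * dyadicKernel η k X = (((2 : ℝ) ^ (-k) : ℝ) : ℂ) * dyadicKernel η' k X := by
  have h1 := h ((2 : ℝ) ^ k • X)
  rw [dyadicKernel_eq, dyadicKernel_eq, ← h1, PiLp.smul_apply, smul_eq_mul, zpow_neg]
  have : (2 : ℂ) ^ k ≠ 0 := zpow_ne_zero _ two_ne_zero
  push_cast
  field_simp

/-- Substitute `Y_i = X_i - (X_i - Y_i)`; the difference is absorbed by the kernel at the price of a
new bump and a gain of `2^(-k)`. -/
theorem dyadicKernel_mul_coord {i : Fin 5} (h : ∀ X : R5, (X i : ℂ) * 𝓕⁻ η X = 𝓕⁻ η' X) (k : ℤ)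
    (X Y : R5) (c : ℂ) : dyadicKernel η k (X - Y) * ((Y i : ℂ) * c)
      = (X i : ℂ) * (dyadicKernel η k (X - Y) * c)
        + (-(((2 : ℝ) ^ (-k) : ℝ) : ℂ)) * (dyadicKernel η' k (X - Y) * c) := by
  have h1 := coord_mul_dyadicKernel h k (X - Y)
  rw [PiLp.sub_apply] at h1
  push_cast at h1 ⊢
  linear_combination c * (-1) * h1

theorem IsAnnularBump.integrable_dyadicKernel_mul_coord (hη : IsAnnularBump η)
    (hm : IsSymbolOfOrder s m) (hs : -(5 / 2) < s) (hs0 : s ≤ 0) (i : Fin 5) (G : R5 → ℂ) (k : ℤ)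
    (X : R5) :
    Integrable fun Y => dyadicKernel η k (X - Y) * ((Y i : ℂ) * multiplierOp m G Y) := by
  obtain ⟨η', hη', h⟩ := hη.exists_coord_mul i
  simp only [dyadicKernel_mul_coord h]
  exact ((hη.integrable_dyadicKernel_mul hm hs hs0 G k X).const_mul _).add
    ((hη'.integrable_dyadicKernel_mul hm hs hs0 G k X).const_mul _)

/-- On axis balls a radial coordinate in front of the multiplier gains a factor `2^{-k}`. -/
theorem IsAnnularBump.localBound_coord (hη : IsAnnularBump η) (hm : IsSymbolOfOrder s m)
    (hs : -(5 / 2) < s) (hs0 : s ≤ 0) (i : Fin 4) :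
    LocalBound (s - 1 / 2) fun G k X =>
      ∫ Y, dyadicKernel η k (X - Y) * ((Y i.castSucc : ℂ) * multiplierOp m G Y) := by
  obtain ⟨η', hη', h⟩ := hη.exists_coord_mul i.castSucc
  have h1 := (hη.localBound hm hs hs0).mul_of_norm_le (f := fun _ X => (X i.castSucc : ℂ))
    fun k z X hX => coe_norm_castSucc_le hX i
  have h2 := (hη'.localBound hm hs hs0).mul_of_norm_le
    (f := fun k _ => -(((2 : ℝ) ^ (-k) : ℝ) : ℂ)) fun k z X _ => by
      rw [norm_neg, Complex.norm_of_nonneg (by positivity)]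
  have h3 := h1.add h2
  rw [show s + 1 / 2 - 1 = s - 1 / 2 by ring] at h3
  convert h3 using 4 with G k X
  rw [← integral_const_mul, ← integral_const_mul, ← integral_add
    ((hη.integrable_dyadicKernel_mul hm hs hs0 G k X).const_mul _)
    ((hη'.integrable_dyadicKernel_mul hm hs hs0 G k X).const_mul _)]
  exact integral_congr_ae (.of_forall fun Y => dyadicKernel_mul_coord h k X Y _)

end Coordinate

/-! ### Block bounds for the meridional velocity. -/

section Velocity

variable {η : R5 → ℂ}

theorem meridionalVelocity_castSucc (G : R5 → ℂ) (Y : R5) (i : Fin 4) :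
    meridionalVelocity G Y i.castSucc
      = -((Y i.castSucc : ℂ) * multiplierOp (gradInvLaplaceSymbol (Fin.last 4)) G Y) := by
  simp only [meridionalVelocity, Fin.snoc_castSucc]

theorem meridionalVelocity_last (G : R5 → ℂ) (Y : R5) :
    meridionalVelocity G Y (Fin.last 4) = 2 * multiplierOp invLaplaceSymbol G Y
      + ∑ i : Fin 4, (Y i.castSucc : ℂ) * multiplierOp (gradInvLaplaceSymbol i.castSucc) G Y := by
  simp only [meridionalVelocity, Fin.snoc_last]

theorem IsAnnularBump.integrable_dyadicKernel_mul_meridionalVelocity (hη : IsAnnularBump η)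
    (G : R5 → ℂ) (k : ℤ) (X : R5) (i : Fin 5) :
    Integrable fun Y => dyadicKernel η k (X - Y) * meridionalVelocity G Y i := by
  have hc := fun (i : Fin 4) (j : Fin 5) => hη.integrable_dyadicKernel_mul_coord
    (isSymbolOfOrder_gradInvLaplaceSymbol j) (by norm_num) (by norm_num) i.castSucc G k X
  induction i using Fin.lastCases with
  | cast i =>
    simp only [meridionalVelocity_castSucc, mul_neg]
    exact (hc i _).neg
  | last =>
    simp only [meridionalVelocity_last, mul_add, Finset.mul_sum, mul_left_comm _ (2 : ℂ)]
    exact ((hη.integrable_dyadicKernel_mul isSymbolOfOrder_invLaplaceSymbol (by norm_num)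
      (by norm_num) G k X).const_mul 2).add (integrable_finsetSum _ fun i _ => hc i _)

/-- The two kinds of terms share one exponent: `-1 - 1/2` for a coordinate times an order `-1`
multiplier, `-2 + 1/2` for the potential. -/
theorem IsAnnularBump.localBound_meridionalVelocity (hη : IsAnnularBump η) (i : Fin 5) :
    LocalBound (-(3 / 2)) fun G k X =>
      ∫ Y, dyadicKernel η k (X - Y) * meridionalVelocity G Y i := by
  have hb : ∀ (i : Fin 4) (j : Fin 5), LocalBound (-(3 / 2)) fun G k X =>
      ∫ Y, dyadicKernel η k (X - Y) *
        ((Y i.castSucc : ℂ) * multiplierOp (gradInvLaplaceSymbol j) G Y) := fun i j => by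
    have := hη.localBound_coord (isSymbolOfOrder_gradInvLaplaceSymbol j) (by norm_num)
      (by norm_num) i
    norm_num at this
    exact this
  induction i using Fin.lastCases with
  | cast i =>
    have h := (hb i (Fin.last 4)).const_mul (-1)
    simp only [meridionalVelocity_castSucc, mul_neg, integral_neg]
    simpa only [neg_one_mul] using h
  | last =>
    have h0 : LocalBound (-(3 / 2)) fun G k X =>
        ∫ Y, dyadicKernel η k (X - Y) * multiplierOp invLaplaceSymbol G Y := by
      have := hη.localBound isSymbolOfOrder_invLaplaceSymbol (by norm_num) (by norm_num)
      norm_num at this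
      exact this
    have h := (h0.const_mul 2).add (LocalBound.sum Finset.univ fun i : Fin 4 => hb i i.castSucc)
    convert h using 4 with G k X
    have hc := fun i : Fin 4 => hη.integrable_dyadicKernel_mul_coord
      (isSymbolOfOrder_gradInvLaplaceSymbol i.castSucc) (by norm_num) (by norm_num) i.castSucc G k X
    simp only [meridionalVelocity_last, mul_add, Finset.mul_sum, mul_left_comm _ (2 : ℂ)]
    rw [integral_add ((hη.integrable_dyadicKernel_mul isSymbolOfOrder_invLaplaceSymbol
      (by norm_num) (by norm_num) G k X).const_mul 2) (integrable_finsetSum _ fun i _ => hc i),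
      integral_const_mul, integral_finsetSum _ fun i _ => hc i]

end Velocity

end LiftedFlow

theorem mainTheorem9 (ψ : R5 → ℝ) (hψ : IsLittlewoodPaley ψ) :
    (∀ m : Fin 5 → R5 → ℂ, (∀ i, IsSymbolOfOrder (-1) (m i)) →
      ∃ C : ℝ≥0, ∀ (S : Set ℤ) (g : ℝ × ℝ → ℝ) (k₀ k : ℤ) (z : ℝ),
        MemLp g 2 mu5 → k₀ ≤ k → Icc k₀ k ⊆ S → IsProximal k₀ g →
        eLpNorm ((axisBall ((2 : ℝ) ^ (-k)) z).indicator
            (lpBlock ψ k (multiplierField m (lift g)))) ∞ volume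
          ≤ C * singularMass S g ^ (1 / 2 : ℝ) * ENNReal.ofReal ((2 : ℝ) ^ (-(k : ℝ) / 2))) ∧
    (∀ J : ℤ, ∃ C : ℝ≥0, ∀ (S : Set ℤ) (g : ℝ × ℝ → ℝ) (k₀ k : ℤ) (z : ℝ),
        MemLp g 2 mu5 → k₀ ≤ k → Icc k₀ k ⊆ S → IsProximal k₀ g → J ≤ k →
        eLpNorm ((axisBall ((2 : ℝ) ^ (-k)) z).indicator
            (lpBlock ψ k (meridionalVelocity (lift g)))) ∞ volume
          ≤ C * singularMass S g ^ (1 / 2 : ℝ) * ENNReal.ofReal ((2 : ℝ) ^ (-(k : ℝ) / 2))) := by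
  have hη := hψ.isAnnularBump
  constructor
  · intro m hm
    obtain ⟨C, hC⟩ := exists_eLpNorm_lpBlock_le (ψ := ψ) (e := -1 + 1 / 2)
      (U := fun G => multiplierField m G)
      (fun G k X i => by
        rw [lpKernel_eq_dyadicKernel]
        exact hη.integrable_dyadicKernel_mul (hm i) (by norm_num) (by norm_num) G k X)
      (fun i => by
        simp only [lpKernel_eq_dyadicKernel]
        exact hη.localBound (hm i) (by norm_num) (by norm_num))
    refine ⟨C, fun S g k₀ k z hg hk hS hp => (hC S g k₀ k z hg hk hS hp).trans_eq ?_⟩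
    congr 3
    ring
  · intro J
    obtain ⟨C, hC⟩ := exists_eLpNorm_lpBlock_le (ψ := ψ) (e := -(3 / 2))
      (U := fun G => meridionalVelocity G)
      (fun G k X i => by
        rw [lpKernel_eq_dyadicKernel]
        exact hη.integrable_dyadicKernel_mul_meridionalVelocity G k X i)
      (fun i => by
        simp only [lpKernel_eq_dyadicKernel]
        exact hη.localBound_meridionalVelocity i)
    -- `2^(-3k/2) = 2^(-k) 2^(-k/2)`, and `2^(-k) ≤ 2^(-J)`.
    refine ⟨C * (2 : ℝ≥0) ^ (-J), fun S g k₀ k z hg hk hS hp hJ =>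
      (hC S g k₀ k z hg hk hS hp).trans ?_⟩
    have h1 : ENNReal.ofReal ((2 : ℝ) ^ (-(3 / 2) * (k : ℝ)))
        ≤ ((2 : ℝ≥0) ^ (-J) : ℝ≥0) * ENNReal.ofReal ((2 : ℝ) ^ (-(k : ℝ) / 2)) := by
      rw [← ENNReal.ofReal_coe_nnreal, ← ENNReal.ofReal_mul (by positivity)]
      refine ENNReal.ofReal_le_ofReal ?_
      push_cast
      rw [← Real.rpow_intCast, ← Real.rpow_add two_pos]
      refine Real.rpow_le_rpow_of_exponent_le one_le_two ?_
      have : (J : ℝ) ≤ k := by exact_mod_cast hJ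
      push_cast
      linarith
    calc _ ≤ C * singularMass S g ^ (1 / 2 : ℝ) * (((2 : ℝ≥0) ^ (-J) : ℝ≥0) *
          ENNReal.ofReal ((2 : ℝ) ^ (-(k : ℝ) / 2))) := by gcongr
      _ = _ := by rw [ENNReal.coe_mul]; ring
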